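/- Let $V$ and $W$ be finite-dimensional complex vector spaces and let $G\subset\operatorname{GL}(V)$ and $H\subset\operatorname{GL}(W)$ be finite subgroups. Let $V/G$ and $W/H$ be the quotient varieties, that is, the complex affine varieties with coordinate rings $\mathbb{C}[V]^G$ and $\mathbb{C}[W]^H$, regarded as complex analytic spaces; their points are the orbits. A pseudoreflection is an element whose fixed subspace is a hyperplane. For a pseudoreflection $g\in G$ let $V^{\langle g\rangle}$ be the set of points of $V$ whose isotropy group in $G$ is the subgroup generated by $g$. The codimension-one strata of $V/G$ are the distinct non-empty images $C_1,\dots,C_k$ in $V/G$ of the sets $V^{\langle g\rangle}$, $g\in G$ a pseudoreflection; if $C_i$ is the image of $V^{\langle g_i\rangle}$, let $r_i$ be the order of $g_i$ (it depends only on $C_i$). Similarly let $D_1,\dots,D_l$ be the codimension-one strata of $W/H$, with associated orders $s_1,\dots,s_l$. Theorem. Suppose that $k=l$ and that $f\colon V/G\to W/H$ is a biholomorphism which sends each closure $\overline{C_i}$ onto a closure $\overline{D_j}$ such that $r_i=s_j$. Then there is a biholomorphic map $F\colon V\to W$ such that $F$ sends $G$-orbits onto $H$-orbits, $F^{-1}$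 sends $H$-orbits onto $G$-orbits, and $F$ induces $f$, i.e. $f(Gv)=H\,F(v)$ for all $v\in V$. -/

import Mathlib

open Topology

noncomputable section

namespace FiniteQuotient

section Quotient

variable {V : Type*} [NormedAddCommGroup V] [NormedSpace ℂ V]

/-- The algebra `ℂ[V]` of polynomial functions on `V`: the algebra of functions generated by the
linear forms. -/
def polynomialFunctions (V : Type*) [NormedAddCommGroup V] [NormedSpace ℂ V] :
    Subalgebra ℂ (V → ℂ) :=
  Algebra.adjoin ℂ (Set.range fun l : Module.Dual ℂ V => (l : V → ℂ))

/-- The quotient variety `V/G`. As a topological space it is the orbit space with the quotient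
topology; its complex structure is given by `IsHolomorphicAt` below. -/
abbrev OrbitSpace (G : Subgroup (V ≃ₗ[ℂ] V)) : Type _ := MulAction.orbitRel.Quotient G V

/-- The quotient map `V → V/G`. -/
def proj (G : Subgroup (V ≃ₗ[ℂ] V)) (v : V) : OrbitSpace G := Quotient.mk _ v

/-- The coordinate ring of the variety `V/G`, that is `ℂ[V]^G` regarded as an algebra of functions
on `V/G`: the functions on `V/G` whose pullback to `V` is polynomial. The pullback of a function
on `V/G` is automatically `G`-invariant, and by `exists_regularFunction` every invariant polynomial
arises. -/
def regularFunctions (G : Subgroup (V ≃ₗ[ℂ] V)) : Set (OrbitSpace G → ℂ) :=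
  {φ | φ ∘ proj G ∈ polynomialFunctions V}

theorem exists_regularFunction (G : Subgroup (V ≃ₗ[ℂ] V)) (p : V → ℂ)
    (hp : p ∈ polynomialFunctions V) (hG : ∀ (g : G) (v : V), p (g • v) = p v) :
    ∃! φ : OrbitSpace G → ℂ, φ ∈ regularFunctions G ∧ φ ∘ proj G = p := by
  refine ⟨fun y => Quotient.liftOn y p ?_, ⟨?_, ?_⟩, ?_⟩
  · rintro a b ⟨g, rfl⟩
    exact hG g b
  · exact hp
  · rfl
  · rintro ψ ⟨-, rfl⟩
    funext y
    induction y using Quotient.inductionOn with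
    | _ v => rfl

/-- Holomorphic functions (germs) on the complex analytic variety `V/G`: near `y` the function `φ`
is a holomorphic function of finitely many regular functions. If `p₁, …, pₘ` generate `ℂ[V]^G`,
these are the functions that near `y` are restrictions of holomorphic functions on open subsets
of `ℂᵐ`, for the embedding `(p₁, …, pₘ)` of `V/G` in `ℂᵐ`. -/
def IsHolomorphicAt (G : Subgroup (V ≃ₗ[ℂ] V)) (φ : OrbitSpace G → ℂ) (y : OrbitSpace G) : Prop :=
  ∃ (m : ℕ) (p : Fin m → OrbitSpace G → ℂ) (h : (Fin m → ℂ) → ℂ),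
    (∀ i, p i ∈ regularFunctions G) ∧ AnalyticAt ℂ h (fun i => p i y) ∧
      ∀ᶠ x in 𝓝 y, φ x = h (fun i => p i x)

/-- `g` is a pseudoreflection: its fixed subspace is a hyperplane. -/
def IsPseudoreflection (g : V ≃ₗ[ℂ] V) : Prop :=
  Module.finrank ℂ (LinearMap.ker ((g : V →ₗ[ℂ] V) - LinearMap.id)) + 1 = Module.finrank ℂ V

/-- The set `V^{<g>}` of the points of `V` whose isotropy group is generated by `g`. -/
def isotropyGeneratedBy (G : Subgroup (V ≃ₗ[ℂ] V)) (g : G) : Set V :=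
  {v | MulAction.stabilizer G v = Subgroup.zpowers g}

/-- `C` is a codimension one stratum of `V/G` with associated order `r`: it is non-empty and is
the image of `V^{<g>}` for a pseudoreflection `g` in `G` of order `r`. -/
def IsCodimOneStratum (G : Subgroup (V ≃ₗ[ℂ] V)) (C : Set (OrbitSpace G)) (r : ℕ) : Prop :=
  C.Nonempty ∧ ∃ g : G, IsPseudoreflection (g : V ≃ₗ[ℂ] V) ∧ orderOf g = r ∧
    C = proj G '' isotropyGeneratedBy G g

/-- The set of codimension one strata of `V/G`. -/
def codimOneStrata (G : Subgroup (V ≃ₗ[ℂ] V)) : Set (Set (OrbitSpace G)) :=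
  {C | ∃ r, IsCodimOneStratum G C r}

end Quotient

section Maps

variable {V : Type*} [NormedAddCommGroup V] [NormedSpace ℂ V]
  {W : Type*} [NormedAddCommGroup W] [NormedSpace ℂ W]

/-- A holomorphic map `V/G → W/H`: continuous, and pulling back germs of holomorphic functions to
germs of holomorphic functions. -/
def IsHolomorphicMap (G : Subgroup (V ≃ₗ[ℂ] V)) (H : Subgroup (W ≃ₗ[ℂ] W))
    (f : OrbitSpace G → OrbitSpace H) : Prop :=
  Continuous f ∧ ∀ (y : OrbitSpace G) (φ : OrbitSpace H → ℂ),
    IsHolomorphicAt H φ (f y) → IsHolomorphicAt G (φ ∘ f) y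

/-- A biholomorphism `V/G → W/H`. -/
def IsBiholomorphism (G : Subgroup (V ≃ₗ[ℂ] V)) (H : Subgroup (W ≃ₗ[ℂ] W))
    (f : OrbitSpace G ≃ OrbitSpace H) : Prop :=
  IsHolomorphicMap G H f ∧ IsHolomorphicMap H G f.symm

end Maps

end FiniteQuotient

end

noncomputable section

open Topology Filter Set Metric MeasureTheory

/-! ### Cauchy integrals in several variables and Riemann extension across one hyperplane. -/

section SeveralComplexVariables

variable {E F : Type*} [NormedAddCommGroup E] [NormedSpace ℂ E] [FiniteDimensional ℂ E]
  [NormedAddCommGroup F] [NormedSpace ℂ F]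

/-! Write `R v w` for `f (Gv) = Hw`. A lift of `f⁻¹` is a holomorphic `Φ : W → V` with `R (Φ w) w`.
The situation is symmetric in `f` and `f⁻¹`, so everything is proved for `OrbitCorrespondence`, and
global lifts are found in both directions. Their composites are multiplication by a single element
of `H` or of `G`, hence the lifts are bijective (`OrbitCorrespondence.exists_equiv`).

Call a point good if its isotropy group fixes a hyperplane pointwise (`FixesHyperplane`; trivial
isotropy is allowed). The other points lie in finitely many subspaces of codimension at least two.
At a good point with non-trivial isotropy the group is cyclic, generated by a pseudoreflection of
order `r` with mirror `l = 0`, and the local invariants are the projection to the mirror and `l ^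
r`. If `R v w` with both points good, the matching of strata makes the two orders equal. So `l ^ r`,
transported to `W`, is a unit times `m ^ r`, where `m = 0` is the mirror at `w`, and it has a
holomorphic `r`-th root; this is a local lift (`OrbitCorrespondence.exists_local_lift`).

Two local lifts on a convex set differ by one element of `G`, so lifts continue along segments. The
segments from a base point that might meet the bad subspaces lie in finitely many hyperplanes, and
Riemann's theorem extends the lift across these (`OrbitCorrespondence.exists_lift_of_convex`).

It remains to see that `R` matches good points with good points
(`OrbitCorrespondence.fixesHyperplane`). Near `w` related to a good `v` a lift exists by the same
continuation. Its Jacobian is non-zero off codimension two, hence everywhere, and its derivative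
intertwines isotropy at `w` with isotropy at the image, so `w` is good too. -/

theorem exists_lipschitzOnWith_ball_of_isCompact {K O : Set E} (hK : IsCompact K) (hO : IsOpen O)
    (hKO : K ⊆ O) {f : E → F} (hf : DifferentiableOn ℂ f O) :
    ∃ ε > 0, ∃ C : NNReal, ∀ p ∈ K, ball p ε ⊆ O ∧ LipschitzOnWith C f (ball p ε) := by
  have : ProperSpace E := FiniteDimensional.proper ℂ E
  obtain ⟨δ, hδ, hδO⟩ := hK.exists_cthickening_subset_open hO hKO
  have hcomp : IsCompact (cthickening δ K) := hK.cthickening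
  obtain ⟨M, hM⟩ := hcomp.exists_bound_of_continuousOn (hf.continuousOn.mono hδO)
  have hsub : ∀ p ∈ K, ball p δ ⊆ cthickening δ K := fun p hp =>
    (ball_subset_thickening hp δ).trans (thickening_subset_cthickening δ K)
  refine ⟨δ / 2, by positivity, (2 * M / (δ / 2)).toNNReal, fun p hp => ?_⟩
  have h1 : ball p (δ / 2) ⊆ cthickening δ K :=
    (ball_subset_ball (by linarith)).trans (hsub p hp)
  refine ⟨h1.trans hδO, ?_⟩
  refine Convex.lipschitzOnWith_of_nnnorm_fderiv_le (𝕜 := ℂ)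
    (fun x hx => hf.differentiableAt (hO.mem_nhds (hδO (h1 hx)))) (fun x hx => ?_)
    (convex_ball p (δ / 2))
  have h2 : ball x (δ / 2) ⊆ cthickening δ K := by
    refine (ball_subset_ball' ?_).trans (hsub p hp)
    have := mem_ball.1 hx
    linarith
  have h3 : ‖fderiv ℂ f x‖ ≤ 2 * M / (δ / 2) := by
    refine Complex.norm_fderiv_le_div_of_mapsTo_ball (hf.mono (h2.trans hδO)) (fun y hy => ?_)
      (by positivity)
    rw [mem_closedBall, dist_eq_norm]
    calc ‖f y - f x‖ ≤ ‖f y‖ + ‖f x‖ := norm_sub_le _ _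
      _ ≤ 2 * M := by linarith [hM y (h2 hy), hM x (h1 hx)]
  rw [← NNReal.coe_le_coe, coe_nnnorm]
  exact h3.trans (Real.le_coe_toNNReal _)

/-- Integrals of a holomorphic function along translates of a curve depend holomorphically on the
translation. -/
theorem differentiableAt_setIntegral_translate [FiniteDimensional ℂ F] {O : Set E} (hO : IsOpen O)
    {f : E → F} (hf : DifferentiableOn ℂ f O) {γ : ℝ → E} (hγ : Continuous γ) {k : ℝ → ℂ}
    (hk : Continuous k) {a b : ℝ} {x₀ : E} (hx₀ : ∀ θ ∈ Icc a b, x₀ + γ θ ∈ O) :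
    DifferentiableAt ℂ (fun x => ∫ θ in Ioc a b, k θ • f (x + γ θ)) x₀ := by
  have : ProperSpace E := FiniteDimensional.proper ℂ E
  borelize E
  have hK : IsCompact ((fun θ => x₀ + γ θ) '' Icc a b) :=
    isCompact_Icc.image (by fun_prop)
  obtain ⟨ε, hε, C, hC⟩ := exists_lipschitzOnWith_ball_of_isCompact hK hO
    (by rintro _ ⟨θ, hθ, rfl⟩; exact hx₀ θ hθ) hf
  have hmem : ∀ x ∈ ball x₀ ε, ∀ θ ∈ Icc a b, x + γ θ ∈ ball (x₀ + γ θ) ε := by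
    intro x hx θ _
    simpa [mem_ball, dist_eq_norm] using hx
  have hcont : ∀ x ∈ ball x₀ ε, ContinuousOn (fun θ => k θ • f (x + γ θ)) (Icc a b) := by
    intro x hx
    refine hk.continuousOn.smul (hf.continuousOn.comp (by fun_prop) ?_)
    intro θ hθ
    exact (hC _ ⟨θ, hθ, rfl⟩).1 (hmem x hx θ hθ)
  obtain ⟨Mk, hMk⟩ := isCompact_Icc.exists_bound_of_continuousOn (hk.continuousOn (s := Icc a b))
  have hfin : volume (Ioc a b) ≠ ⊤ := by simp
  refine (hasFDerivAt_integral_of_dominated_loc_of_lip (𝕜 := ℂ) (μ := volume.restrict (Ioc a b))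
    (F := fun x θ => k θ • f (x + γ θ)) (F' := fun θ => k θ • fderiv ℂ f (x₀ + γ θ))
    (bound := fun _ => Mk * C) (ball_mem_nhds x₀ hε) ?_ ?_ ?_ ?_ ?_ ?_).2.differentiableAt
  · filter_upwards [ball_mem_nhds x₀ hε] with x hx
    exact ((hcont x hx).mono Ioc_subset_Icc_self).aestronglyMeasurable measurableSet_Ioc
  · exact ((hcont x₀ (mem_ball_self hε)).integrableOn_Icc).mono_set Ioc_subset_Icc_self
  · refine (hk.aestronglyMeasurable).smul ?_
    have : CompleteSpace F := FiniteDimensional.complete ℂ F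
    have : ProperSpace (E →L[ℂ] F) := FiniteDimensional.proper ℂ _
    borelize (E →L[ℂ] F)
    exact ((measurable_fderiv ℂ f).comp
      (show Measurable fun θ => x₀ + γ θ from
        (by fun_prop : Continuous fun θ => x₀ + γ θ).measurable)).aestronglyMeasurable
  · refine (ae_restrict_iff' measurableSet_Ioc).2 (Eventually.of_forall fun θ hθ => ?_)
    have hθ' := Ioc_subset_Icc_self hθ
    refine LipschitzOnWith.of_dist_le_mul fun x hx y hy => ?_
    have h1 := ((hC _ ⟨θ, hθ', rfl⟩).2).dist_le_mul _ (hmem x hx θ hθ') _ (hmem y hy θ hθ')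
    have hMk0 : 0 ≤ Mk := (norm_nonneg _).trans (hMk θ hθ')
    rw [Real.coe_nnabs, abs_of_nonneg (by positivity), dist_smul₀]
    rw [dist_add_right] at h1
    calc ‖k θ‖ * dist (f (x + γ θ)) (f (y + γ θ)) ≤ Mk * (C * dist x y) :=
          mul_le_mul (hMk θ hθ') h1 dist_nonneg hMk0
      _ = Mk * C * dist x y := by ring
  · exact integrable_const _
  · refine (ae_restrict_iff' measurableSet_Ioc).2 (Eventually.of_forall fun θ hθ => ?_)
    have h1 : HasFDerivAt f (fderiv ℂ f (x₀ + γ θ)) (x₀ + γ θ) :=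
      (hf.differentiableAt (hO.mem_nhds (hx₀ θ (Ioc_subset_Icc_self hθ)))).hasFDerivAt
    exact ((hasFDerivAt_comp_add_right (γ θ)).2 h1).const_smul (k θ)

theorem differentiableAt_circleIntegral_translate [FiniteDimensional ℂ F] {O : Set E}
    (hO : IsOpen O) {f : E → F} (hf : DifferentiableOn ℂ f O) {κ : ℂ → ℂ} {ρ : ℝ}
    (hκ : Continuous fun θ => κ (circleMap 0 ρ θ)) {u x₀ : E}
    (hx₀ : ∀ θ : ℝ, x₀ + circleMap 0 ρ θ • u ∈ O) :
    DifferentiableAt ℂ (fun x => ∮ z in C(0, ρ), κ z • f (x + z • u)) x₀ := by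
  have h := differentiableAt_setIntegral_translate hO hf
    (γ := fun θ => circleMap 0 ρ θ • u) (by fun_prop)
    (k := fun θ => deriv (circleMap 0 ρ) θ * κ (circleMap 0 ρ θ))
    (by
      simp only [deriv_circleMap]
      exact ((continuous_circleMap 0 ρ).mul continuous_const).mul hκ)
    (a := 0) (b := 2 * Real.pi)
    (fun θ _ => hx₀ θ)
  refine h.congr_of_eventuallyEq (Eventually.of_forall fun x => ?_)
  simp only [circleIntegral]
  rw [intervalIntegral.integral_of_le Real.two_pi_pos.le]
  simp only [smul_smul]

/-- Cauchy's formula on the complex line through `x` in the direction `e` writes the derivative as a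
circle integral of translates of `f`. This is what makes Jacobian determinants holomorphic. -/
theorem differentiableAt_fderiv_apply [FiniteDimensional ℂ F] {O : Set E} (hO : IsOpen O)
    {f : E → F} (hf : DifferentiableOn ℂ f O) (e : E) {x₀ : E} (hx₀ : x₀ ∈ O) :
    DifferentiableAt ℂ (fun x => fderiv ℂ f x e) x₀ := by
  have : CompleteSpace F := FiniteDimensional.complete ℂ F
  obtain ⟨R, hR, hRO⟩ := Metric.isOpen_iff.1 hO x₀ hx₀
  -- Chosen so that `‖z • e‖ < R / 2` for `‖z‖ ≤ ρ`; the `+ 1` covers `e = 0`.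
  set ρ : ℝ := R / (2 * (‖e‖ + 1)) with hρ
  have hρ0 : 0 < ρ := by positivity
  have hρe : ρ * ‖e‖ < R / 2 := by
    have : ρ * (‖e‖ + 1) = R / 2 := by rw [hρ]; field_simp
    nlinarith
  have hmem : ∀ x ∈ ball x₀ (R / 2), ∀ z ∈ closedBall (0 : ℂ) ρ, x + z • e ∈ O := by
    intro x hx z hz
    refine hRO ?_
    rw [mem_ball, dist_eq_norm] at hx ⊢
    rw [mem_closedBall_zero_iff] at hz
    calc ‖x + z • e - x₀‖ = ‖(x - x₀) + z • e‖ := by congr 1; abel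
      _ ≤ ‖x - x₀‖ + ‖z‖ * ‖e‖ := (norm_add_le _ _).trans (by rw [norm_smul])
      _ < R := by nlinarith [norm_nonneg e]
  have hmain : (fun x => fderiv ℂ f x e) =ᶠ[𝓝 x₀] fun x =>
      (2 * Real.pi * Complex.I : ℂ)⁻¹ • ∮ z in C(0, ρ), (z ^ 2)⁻¹ • f (x + z • e) := by
    filter_upwards [ball_mem_nhds x₀ (half_pos hR)] with x hx
    have hU : IsOpen ((fun z : ℂ => x + z • e) ⁻¹' O) := hO.preimage (by fun_prop)
    have hd : DifferentiableOn ℂ (fun z : ℂ => f (x + z • e)) ((fun z : ℂ => x + z • e) ⁻¹' O) :=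
      hf.comp (by fun_prop) (fun z hz => hz)
    have h1 := Complex.two_pi_I_inv_smul_circleIntegral_sub_sq_inv_smul_of_differentiable hU
      (fun z hz => hmem x hx z hz) hd (mem_ball_self hρ0)
    simp only [sub_zero] at h1
    rw [h1]
    have h2 : HasFDerivAt f (fderiv ℂ f x) (x + (0 : ℂ) • e) := by
      have := hmem x hx 0 (mem_closedBall_self hρ0.le)
      rw [zero_smul, add_zero] at this ⊢
      exact (hf.differentiableAt (hO.mem_nhds this)).hasFDerivAt
    have h3 : HasDerivAt (fun z : ℂ => x + z • e) e 0 := by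
      simpa using ((hasDerivAt_id (0 : ℂ)).smul_const e).const_add x
    exact (h2.comp_hasDerivAt (0 : ℂ) h3).deriv.symm
  refine DifferentiableAt.congr_of_eventuallyEq ?_ hmain
  refine DifferentiableAt.const_smul ?_ _
  refine differentiableAt_circleIntegral_translate hO hf ?_ (fun θ => ?_)
  · refine Continuous.inv₀ (by fun_prop) fun θ => pow_ne_zero _ ?_
    simp [circleMap, hρ0.ne']
  · exact hmem x₀ (mem_ball_self (half_pos hR)) _ (circleMap_mem_closedBall 0 hρ0.le θ)

/-- Riemann's extension theorem across a hyperplane. -/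
theorem exists_differentiableOn_extension_of_ker [FiniteDimensional ℂ F] {B : Set E}
    (hB : IsOpen B) (l : E →L[ℂ] ℂ) (hl : l ≠ 0) {f : E → F}
    (hf : DifferentiableOn ℂ f (B ∩ {x | l x ≠ 0}))
    (hb : ∀ x ∈ B, ∃ M : ℝ, ∀ᶠ y in 𝓝 x, l y ≠ 0 → ‖f y‖ ≤ M) :
    ∃ g : E → F, DifferentiableOn ℂ g B ∧ ∀ x, l x ≠ 0 → g x = f x := by
  classical
  have : CompleteSpace F := FiniteDimensional.complete ℂ F
  obtain ⟨u, hu⟩ : ∃ u, l u = 1 := by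
    obtain ⟨v, hv⟩ : ∃ v, l v ≠ 0 := by
      by_contra! h
      exact hl (ContinuousLinearMap.ext h)
    exact ⟨(l v)⁻¹ • v, by simp [hv]⟩
  have hopen : IsOpen {x | l x ≠ 0} := isOpen_ne_fun l.continuous continuous_const
  -- On the hyperplane the value is the limit along the transversal line in the direction `u`, where
  -- `l u = 1`.
  set g : E → F := fun x =>
    if l x = 0 then limUnder (𝓝[≠] (0 : ℂ)) (fun z : ℂ => f (x + z • u)) else f x with hg
  have hgf : ∀ x, l x ≠ 0 → g x = f x := fun x hx => by simp [hg, hx]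
  refine ⟨g, fun x₀ hx₀ => DifferentiableAt.differentiableWithinAt ?_, hgf⟩
  by_cases hlx₀ : l x₀ ≠ 0
  · refine (hf.differentiableAt ((hB.inter hopen).mem_nhds ⟨hx₀, hlx₀⟩)).congr_of_eventuallyEq ?_
    filter_upwards [hopen.mem_nhds hlx₀] with x hx using hgf x hx
  push Not at hlx₀
  obtain ⟨M, hM⟩ := hb x₀ hx₀
  obtain ⟨R, hR, hRO⟩ := Metric.mem_nhds_iff.1 (Filter.inter_mem (hB.mem_nhds hx₀) hM)
  set ρ : ℝ := R / (2 * (‖u‖ + 1)) with hρ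
  have hρ0 : 0 < ρ := by positivity
  have hρe : ρ * ‖u‖ < R / 2 := by
    have : ρ * (‖u‖ + 1) = R / 2 := by rw [hρ]; field_simp
    nlinarith
  have hmem : ∀ x ∈ ball x₀ (R / 2), ∀ z ∈ closedBall (0 : ℂ) ρ, x + z • u ∈ ball x₀ R := by
    intro x hx z hz
    rw [mem_ball, dist_eq_norm] at hx ⊢
    rw [mem_closedBall_zero_iff] at hz
    calc ‖x + z • u - x₀‖ = ‖(x - x₀) + z • u‖ := by congr 1; abel
      _ ≤ ‖x - x₀‖ + ‖z‖ * ‖u‖ := (norm_add_le _ _).trans (by rw [norm_smul])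
      _ < R := by nlinarith [norm_nonneg u]
  have hsmall : ∀ᶠ x in 𝓝 x₀, ‖l x‖ < ρ := by
    refine l.continuous.norm.continuousAt.eventually (Iio_mem_nhds ?_)
    simpa [hlx₀] using hρ0
  -- The line `x + z • u` meets the hyperplane only at `z = -l x`, inside the circle of radius `ρ`.
  -- After removing this singularity, Cauchy's formula at `z = 0` only uses values of `f` on the
  -- circle, off the hyperplane.
  have hmain : g =ᶠ[𝓝 x₀] fun x =>
      (2 * Real.pi * Complex.I : ℂ)⁻¹ • ∮ z in C(0, ρ), z⁻¹ • f (x + z • u) := by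
    filter_upwards [ball_mem_nhds x₀ (half_pos hR), hsmall] with x hx hlx
    set φ : ℂ → F := fun z => f (x + z • u) with hφ
    set c : ℂ := -l x with hc
    set s : Set ℂ := (fun z : ℂ => x + z • u) ⁻¹' ball x₀ R with hs
    have hso : IsOpen s := isOpen_ball.preimage (by fun_prop)
    have hsub : closedBall (0 : ℂ) ρ ⊆ s := fun z hz => hmem x hx z hz
    have hlz : ∀ z : ℂ, l (x + z • u) = l x + z := fun z => by simp [hu]
    have hne : ∀ z : ℂ, z ≠ c → l (x + z • u) ≠ 0 := by
      intro z hz h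
      rw [hlz] at h
      exact hz (by rw [hc]; linear_combination h)
    have hcs : s ∈ 𝓝 c := hso.mem_nhds (hsub (by simpa [hc] using hlx.le))
    have hΦ := Complex.differentiableOn_update_limUnder_of_bddAbove (f := φ) hcs
      (hf.comp (by fun_prop) (fun z hz => ⟨(hRO hz.1).1, hne z hz.2⟩))
      ⟨M, by rintro _ ⟨z, hz, rfl⟩; exact (hRO hz.1).2 (hne z hz.2)⟩
    have h1 := (hΦ.mono hsub).diffContOnCl_ball subset_rfl
      |>.two_pi_i_inv_smul_circleIntegral_sub_inv_smul (mem_ball_self hρ0)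
    have h2 : g x = Function.update φ c (limUnder (𝓝[≠] c) φ) 0 := by
      by_cases h0 : l x = 0
      · have hc0 : c = 0 := by simp [hc, h0]
        rw [hc0, Function.update_self]
        simp [hg, h0, hφ]
      · rw [Function.update_of_ne (by simpa [hc, eq_comm] using h0), hgf x h0]
        simp [hφ]
    rw [h2, ← h1]
    congr 1
    refine circleIntegral.integral_congr hρ0.le fun z hz => ?_
    have hzc : z ≠ c := by
      rintro rfl
      rw [mem_sphere_zero_iff_norm, hc, norm_neg] at hz
      exact hlx.ne hz
    simp only [sub_zero]
    rw [Function.update_of_ne hzc]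
  refine DifferentiableAt.congr_of_eventuallyEq ?_ hmain
  refine DifferentiableAt.const_smul ?_ _
  refine differentiableAt_circleIntegral_translate (hB.inter hopen) hf ?_ (fun θ => ⟨?_, ?_⟩)
  · refine Continuous.inv₀ (by fun_prop) fun θ => ?_
    simp [circleMap, hρ0.ne']
  · exact (hRO (hmem x₀ (mem_ball_self (half_pos hR)) _
      (circleMap_mem_closedBall 0 hρ0.le θ))).1
  · simp [hu, hlx₀, circleMap, hρ0.ne']

end SeveralComplexVariables

/-! ### Finite unions of subspaces, the identity theorem, vanishing orders, codimension two. -/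

section SeveralComplexVariablesExtension

/-- Remove the relatively closed sets one at a time: either one of them contains what is left, or a
non-empty open set remains that fewer sets cover. It singles out one group element among finitely
many. -/
theorem exists_open_subset_of_subset_iUnion {X ι : Type*} [TopologicalSpace X] [Finite ι]
    {U : Set X} (hU : IsOpen U) (hne : U.Nonempty) (A : ι → Set X)
    (hA : ∀ i, IsOpen (U \ A i)) (hUA : U ⊆ ⋃ i, A i) :
    ∃ i, ∃ O : Set X, IsOpen O ∧ O.Nonempty ∧ O ⊆ U ∧ O ⊆ A i := by
  classical
  have := Fintype.ofFinite ι
  suffices H : ∀ (s : Finset ι) (U : Set X), IsOpen U → U.Nonempty → (∀ i, IsOpen (U \ A i)) →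
      U ⊆ ⋃ i ∈ s, A i → ∃ i, ∃ O : Set X, IsOpen O ∧ O.Nonempty ∧ O ⊆ U ∧ O ⊆ A i from
    H Finset.univ U hU hne hA (by simpa using hUA)
  intro s
  induction s using Finset.induction_on with
  | empty =>
    intro U _ hne _ h
    obtain ⟨x, hx⟩ := hne
    simpa using h hx
  | insert a s _ ih =>
    intro U hU hne hA h
    by_cases h0 : (U \ A a).Nonempty
    · obtain ⟨i, O, hO, hOne, hOU, hOi⟩ := ih (U \ A a) (hA a) h0
        (fun i => by
          have : (U \ A a) \ A i = (U \ A a) ∩ (U \ A i) := by ext x; simp; tauto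
          rw [this]
          exact (hA a).inter (hA i))
        (fun x hx => by
          have := h hx.1
          simp only [Finset.mem_insert, iUnion_iUnion_eq_or_left, mem_union] at this
          exact this.resolve_left hx.2)
      exact ⟨i, O, hO, hOne, hOU.trans sdiff_subset, hOi⟩
    · rw [not_nonempty_iff_eq_empty, sdiff_eq_empty] at h0
      exact ⟨a, U, hU, hne, subset_rfl, h0⟩

variable {E F : Type*} [NormedAddCommGroup E] [NormedSpace ℂ E] [FiniteDimensional ℂ E]
  [NormedAddCommGroup F] [NormedSpace ℂ F]

theorem dense_forall_notMem_submodule (S : Set (Submodule ℂ E)) (hS : S.Finite)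
    (htop : ∀ L ∈ S, L ≠ ⊤) : Dense {x : E | ∀ L ∈ S, x ∉ L} := by
  have : CompleteSpace E := FiniteDimensional.complete ℂ E
  have h := dense_biInter_of_isOpen (S := S) (f := fun L : Submodule ℂ E => (L : Set E)ᶜ)
    (fun L _ => L.closed_of_finiteDimensional.isOpen_compl) hS.countable
    (fun L hL => interior_eq_empty_iff_dense_compl.1 (by
      by_contra h
      exact htop L hL (L.eq_top_of_nonempty_interior' (nonempty_iff_ne_empty.2 h))))
  convert h using 1
  ext x
  simp

theorem isOpen_forall_notMem_submodule (S : Set (Submodule ℂ E)) (hS : S.Finite) :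
    IsOpen {x : E | ∀ L ∈ S, x ∉ L} := by
  have : {x : E | ∀ L ∈ S, x ∉ L} = ⋂ L ∈ S, (L : Set E)ᶜ := by ext x; simp
  rw [this]
  exact hS.isOpen_biInter fun L _ => L.closed_of_finiteDimensional.isOpen_compl

theorem dense_forall_apply_ne_zero (s : Finset (E →L[ℂ] ℂ)) (hs : ∀ l ∈ s, l ≠ 0) :
    Dense {x : E | ∀ l ∈ s, l x ≠ 0} := by
  have h := dense_forall_notMem_submodule
    ((fun l : E →L[ℂ] ℂ => LinearMap.ker (l : E →ₗ[ℂ] ℂ)) '' (s : Set (E →L[ℂ] ℂ)))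
    (s.finite_toSet.image _) (by
      rintro _ ⟨l, hl, rfl⟩ h
      refine hs l hl (ContinuousLinearMap.ext fun x => ?_)
      have : x ∈ LinearMap.ker (l : E →ₗ[ℂ] ℂ) := by simp only at h; rw [h]; trivial
      exact this)
  simpa using h

omit [FiniteDimensional ℂ E] in
theorem isOpen_forall_apply_ne_zero (s : Finset (E →L[ℂ] ℂ)) :
    IsOpen {x : E | ∀ l ∈ s, l x ≠ 0} := by
  have : {x : E | ∀ l ∈ s, l x ≠ 0} = ⋂ l ∈ s, {x | l x ≠ 0} := by ext x; simp
  rw [this]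
  exact isOpen_biInter_finset fun l _ => isOpen_ne_fun l.continuous continuous_const

/-- Riemann's extension theorem across finitely many hyperplanes. -/
theorem exists_differentiableOn_extension [FiniteDimensional ℂ F] {B : Set E}
    (hB : IsOpen B) (s : Finset (E →L[ℂ] ℂ)) (hs : ∀ l ∈ s, l ≠ 0) {f : E → F}
    (hf : DifferentiableOn ℂ f (B ∩ {x | ∀ l ∈ s, l x ≠ 0}))
    (hb : ∀ x ∈ B, ∃ M : ℝ, ∀ᶠ y in 𝓝 x, (∀ l ∈ s, l y ≠ 0) → ‖f y‖ ≤ M) :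
    ∃ g : E → F, DifferentiableOn ℂ g B ∧ ∀ x, (∀ l ∈ s, l x ≠ 0) → g x = f x := by
  classical
  induction s using Finset.induction_on generalizing f with
  | empty => exact ⟨f, by simpa using hf, fun _ _ => rfl⟩
  | insert l s _ ih =>
    have hl : l ≠ 0 := hs l (by simp)
    have hs' : ∀ l' ∈ s, l' ≠ 0 := fun l' h => hs l' (by simp [h])
    set B' : Set E := B ∩ {x | ∀ l' ∈ s, l' x ≠ 0} with hB'
    have hB'o : IsOpen B' := hB.inter (isOpen_forall_apply_ne_zero s)
    obtain ⟨g₁, hg₁, hg₁f⟩ := exists_differentiableOn_extension_of_ker hB'o l hl (f := f)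
      (hf.mono fun x hx => ⟨hx.1.1, fun l' h' => by
        rcases Finset.mem_insert.1 h' with rfl | h'
        exacts [hx.2, hx.1.2 _ h']⟩)
      (fun x hx => by
        obtain ⟨M, hM⟩ := hb x hx.1
        refine ⟨M, ?_⟩
        filter_upwards [hM, hB'o.mem_nhds hx] with y hy hyB hly
        refine hy fun l' h' => ?_
        rcases Finset.mem_insert.1 h' with rfl | h'
        exacts [hly, hyB.2 _ h'])
    -- The bound for `f` is known only where `l ≠ 0`; it passes to `g₁` on `l = 0` by continuity and
    -- density.
    obtain ⟨g, hg, hgf⟩ := ih hs' hg₁ (fun x hx => by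
      obtain ⟨M, hM⟩ := hb x hx
      refine ⟨M, ?_⟩
      filter_upwards [eventually_eventually_nhds.2 hM, hB.mem_nhds hx] with y hy hyB hys
      have hyB' : y ∈ B' := ⟨hyB, hys⟩
      have hcont : ContinuousAt g₁ y := (hg₁.differentiableAt (hB'o.mem_nhds hyB')).continuousAt
      have hdense : y ∈ closure {x : E | l x ≠ 0} := by
        have := dense_forall_apply_ne_zero {l} (by simpa using hl) y
        simpa using this
      have hNB : (𝓝[{x : E | l x ≠ 0}] y).NeBot := mem_closure_iff_nhdsWithin_neBot.1 hdense
      refine le_of_tendsto ((hcont.norm.tendsto).mono_left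
        (nhdsWithin_le_nhds (s := {x : E | l x ≠ 0}))) ?_
      filter_upwards [self_mem_nhdsWithin, mem_nhdsWithin_of_mem_nhds hy,
        mem_nhdsWithin_of_mem_nhds (hB'o.mem_nhds hyB')] with z hz hzM hzB
      rw [hg₁f z hz]
      refine hzM fun l' h' => ?_
      rcases Finset.mem_insert.1 h' with rfl | h'
      exacts [hz, hzB.2 _ h'])
    refine ⟨g, hg, fun x hx => ?_⟩
    rw [hgf x fun l' h' => hx l' (by simp [h']), hg₁f x (hx l (by simp))]

omit [FiniteDimensional ℂ E] in
-- The complex line through `x₀` and `y` meets `U` in a convex, hence connected, set, and the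
-- one-variable identity theorem applies there.
theorem eqOn_of_convex_of_eventuallyEq [CompleteSpace F] {U : Set E} (hU : IsOpen U)
    (hc : Convex ℝ U) {f g : E → F} (hf : DifferentiableOn ℂ f U) (hg : DifferentiableOn ℂ g U)
    {x₀ : E} (hx₀ : x₀ ∈ U) (h : f =ᶠ[𝓝 x₀] g) : EqOn f g U := by
  intro y hy
  set p : ℂ → E := fun z => x₀ + z • (y - x₀) with hp
  have hpc : Continuous p := by fun_prop
  have hpd : Differentiable ℂ p := by fun_prop
  have hs : IsOpen (p ⁻¹' U) := hU.preimage hpc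
  have hconv : Convex ℝ (p ⁻¹' U) := by
    intro a ha b hb α β hα hβ hαβ
    have : p (α • a + β • b) = α • p a + β • p b := by
      have h1 : (β : ℂ) = 1 - (α : ℂ) := by
        rw [eq_sub_iff_add_eq', ← Complex.ofReal_add, hαβ, Complex.ofReal_one]
      simp only [hp, ← Complex.coe_smul, h1]
      simp only [smul_eq_mul]
      module
    rw [mem_preimage, this]
    exact hc ha hb hα hβ hαβ
  have h0 : p 0 = x₀ := by simp [hp]
  have h1 : p 1 = y := by simp [hp]
  have key := AnalyticOnNhd.eqOn_of_preconnected_of_eventuallyEq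
    ((hf.comp hpd.differentiableOn (fun z hz => hz)).analyticOnNhd hs)
    ((hg.comp hpd.differentiableOn (fun z hz => hz)).analyticOnNhd hs)
    hconv.isPreconnected (z₀ := 0) (show p 0 ∈ U by rw [h0]; exact hx₀)
    (hpc.continuousAt.eventually (p := fun x => f x = g x) (by rw [h0]; exact h))
  have := key (show p 1 ∈ U by rw [h1]; exact hy)
  simpa [h1] using this

/-- If `τ` has order `m` at `0`, invariance gives `ξ ^ m = 1`, so `r ∣ m`, and `m > 0` forces `m ≥
r`. The exponent `r - 1` with little-o is the form used by the higher-order Schwarz lemma. -/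
theorem isLittleO_pow_of_invariant {τ : ℂ → ℂ} (hτ : AnalyticAt ℂ τ 0) (h0 : τ 0 = 0) {r : ℕ}
    (hr : 0 < r) {ξ : ℂ} (hξ : IsPrimitiveRoot ξ r) (hinv : ∀ᶠ z in 𝓝 (0 : ℂ), τ (ξ * z) = τ z) :
    τ =o[𝓝 0] fun z => z ^ (r - 1) := by
  by_cases hz : ∀ᶠ z in 𝓝 (0 : ℂ), τ z = 0
  · exact (Asymptotics.isLittleO_zero _ _).congr' (hz.mono fun z h => h.symm) (EventuallyEq.refl _ _)
  obtain ⟨m, g, hg, hg0, hgm⟩ := hτ.exists_eventuallyEq_pow_smul_nonzero_iff.2 hz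
  simp only [sub_zero, smul_eq_mul] at hgm
  have hm : m ≠ 0 := by
    rintro rfl
    have := hgm.self_of_nhds
    simp [h0] at this
    exact hg0 this.symm
  have hξt : Tendsto (fun z : ℂ => ξ * z) (𝓝 0) (𝓝 0) := by
    have : Continuous fun z : ℂ => ξ * z := by fun_prop
    simpa using this.tendsto 0
  have hξm : ξ ^ m = 1 := by
    have h1 : ∀ᶠ z in 𝓝[≠] (0 : ℂ), ξ ^ m * g (ξ * z) = g z := by
      filter_upwards [mem_nhdsWithin_of_mem_nhds hgm,
        mem_nhdsWithin_of_mem_nhds (hξt.eventually hgm),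
        mem_nhdsWithin_of_mem_nhds hinv, self_mem_nhdsWithin] with z ha hb hc hd
      have h2 : τ z = z ^ m * g z := ha
      have h3 : τ (ξ * z) = (ξ * z) ^ m * g (ξ * z) := hb
      rw [h3, h2, mul_pow] at hc
      have hd' : z ≠ 0 := hd
      exact mul_left_cancel₀ (pow_ne_zero m hd') (by linear_combination hc)
    have hl : Tendsto (fun z => ξ ^ m * g (ξ * z)) (𝓝[≠] (0 : ℂ)) (𝓝 (ξ ^ m * g 0)) :=
      ((hg.continuousAt.tendsto.comp hξt).const_mul (ξ ^ m)).mono_left nhdsWithin_le_nhds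
    have hr' : Tendsto g (𝓝[≠] (0 : ℂ)) (𝓝 (g 0)) :=
      hg.continuousAt.tendsto.mono_left nhdsWithin_le_nhds
    have h2 := tendsto_nhds_unique (hl.congr' h1) hr'
    exact mul_right_cancel₀ hg0 (by linear_combination h2)
  have hrm : r ≤ m := Nat.le_of_dvd (Nat.pos_of_ne_zero hm) (hξ.dvd_of_pow_eq_one m hξm)
  have hO : τ =O[𝓝 0] fun z => z ^ m := by
    have hgO : g =O[𝓝 0] fun _ : ℂ => (1 : ℂ) := hg.continuousAt.isBigO_one ℂ
    have := (Asymptotics.isBigO_refl (fun z : ℂ => z ^ m) (𝓝 0)).mul hgO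
    refine (this.congr' (hgm.mono fun z h => h.symm) (EventuallyEq.refl _ _)).congr_right ?_
    simp
  exact hO.trans_isLittleO (Asymptotics.isLittleO_pow_pow (by omega))

omit [FiniteDimensional ℂ E] in
-- On each line transversal to the mirror `l = 0`, invariance makes `T` vanish to order `r`. The
-- Schwarz lemma on discs of a common radius `ρ` then gives a uniform constant.
theorem exists_norm_le_mul_pow_of_invariant {l : E →L[ℂ] ℂ} {e v : E} (he : l e = 1)
    (hv : l v = 0) {r : ℕ} (hr : 0 < r) {ξ : ℂ} (hξ : IsPrimitiveRoot ξ r) {T : E → ℂ}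
    (hd : ∀ᶠ x in 𝓝 v, DifferentiableAt ℂ T x)
    (hinv : ∀ᶠ x in 𝓝 v, T (x + ((ξ - 1) * l x) • e) = T x)
    (h0 : ∀ᶠ x in 𝓝 v, l x = 0 → T x = 0) :
    ∃ C : ℝ, ∀ᶠ x in 𝓝 v, ‖T x‖ ≤ C * ‖l x‖ ^ r := by
  have hbd : ∀ᶠ x in 𝓝 v, ‖T x‖ ≤ ‖T v‖ + 1 :=
    (hd.self_of_nhds.continuousAt.norm.eventually (Iio_mem_nhds (lt_add_one _))).mono
      fun x hx => le_of_lt hx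
  set M := ‖T v‖ + 1 with hM
  obtain ⟨R, hR, hball⟩ := Metric.eventually_nhds_iff_ball.1 (hd.and (hinv.and (h0.and hbd)))
  set ρ : ℝ := R / (2 * (‖e‖ + 1)) with hρ
  have hρ0 : 0 < ρ := by positivity
  have hρe : ρ * ‖e‖ < R / 2 := by
    have : ρ * (‖e‖ + 1) = R / 2 := by rw [hρ]; field_simp
    nlinarith
  have hnear : ∀ᶠ x in 𝓝 v, x - l x • e ∈ ball v (R / 2) := by
    have : Continuous fun x => x - l x • e := by fun_prop
    refine this.continuousAt.eventually (isOpen_ball.mem_nhds ?_)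
    simpa [hv] using hR
  have hsmall : ∀ᶠ x in 𝓝 v, ‖l x‖ < ρ :=
    l.continuous.norm.continuousAt.eventually (Iio_mem_nhds (by simpa [hv] using hρ0))
  refine ⟨M / ρ ^ r, ?_⟩
  filter_upwards [hnear, hsmall] with x hx hlx
  set y := x - l x • e with hy
  have hly : l y = 0 := by simp [hy, he]
  have hmem : ∀ z ∈ ball (0 : ℂ) ρ, y + z • e ∈ ball v R := by
    intro z hz
    rw [mem_ball, dist_eq_norm] at hx ⊢
    rw [mem_ball_zero_iff] at hz
    calc ‖y + z • e - v‖ = ‖(y - v) + z • e‖ := by congr 1; abel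
      _ ≤ ‖y - v‖ + ‖z‖ * ‖e‖ := (norm_add_le _ _).trans (by rw [norm_smul])
      _ < R := by nlinarith [norm_nonneg e]
  set τ : ℂ → ℂ := fun z => T (y + z • e) with hτ
  have hdτ : DifferentiableOn ℂ τ (ball 0 ρ) := fun z hz =>
    (DifferentiableAt.comp z (hball _ (hmem z hz)).1 (by fun_prop)).differentiableWithinAt
  have hτ0 : τ 0 = 0 := (hball _ (hmem 0 (mem_ball_self hρ0))).2.2.1 (by simp [hly])
  have hlit := isLittleO_pow_of_invariant
    (hdτ.analyticAt (isOpen_ball.mem_nhds (mem_ball_self hρ0))) hτ0 hr hξ (by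
      filter_upwards [ball_mem_nhds (0 : ℂ) hρ0] with z hz
      have := (hball _ (hmem z hz)).2.1
      simp only [hτ]
      rw [← this]
      congr 1
      simp only [map_add, map_smul, hly, he, smul_eq_mul, zero_add, mul_one]
      module)
  have hfin := Complex.dist_le_mul_div_pow_of_mapsTo_ball_of_isLittleO (n := r - 1) (R₂ := M) hdτ
    (fun z hz => by
      rw [hτ0, mem_closedBall_zero_iff]
      exact (hball _ (hmem z hz)).2.2.2)
    (by simpa [hτ0] using hlit.norm_right) (z := l x) (by simpa using hlx)
  rw [hτ0, dist_zero_right, dist_zero_right, Nat.sub_add_cancel hr] at hfin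
  have hxy : τ (l x) = T x := by simp [hτ, hy]
  rw [hxy] at hfin
  calc ‖T x‖ ≤ M * (‖l x‖ / ρ) ^ r := hfin
    _ = M / ρ ^ r * ‖l x‖ ^ r := by rw [div_pow]; ring

/-- A holomorphic function does not vanish if it does not vanish outside a finite union of
subspaces of codimension at least two. -/
theorem ne_zero_of_ne_zero_off_codim_two {B : Set E} (hB : IsOpen B) {J : E → ℂ}
    (hJ : DifferentiableOn ℂ J B) (S : Set (Submodule ℂ E)) (hS : S.Finite)
    (hcodim : ∀ L ∈ S, Module.finrank ℂ L + 2 ≤ Module.finrank ℂ E)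
    (hne : ∀ x ∈ B, (∀ L ∈ S, x ∉ L) → J x ≠ 0) {w : E} (hw : w ∈ B) : J w ≠ 0 := by
  have htop : ∀ L ∈ S, L ≠ ⊤ := by
    rintro L hL rfl
    have := hcodim _ hL
    rw [finrank_top] at this
    omega
  -- The line through `w` in the direction `u` meets the subspaces containing `w` only at `w`, so
  -- `J` has no zero on a small circle around `w` in it.
  obtain ⟨u, hu⟩ := (dense_forall_notMem_submodule S hS htop).nonempty
  have hnear : ∀ᶠ x in 𝓝 w, ∀ L ∈ S, w ∉ L → x ∉ L := by
    have := (isOpen_forall_notMem_submodule {L ∈ S | w ∉ L} (hS.subset (sep_subset _ _))).mem_nhds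
      (show w ∈ {x : E | ∀ L ∈ {L ∈ S | w ∉ L}, x ∉ L} from fun L hL => hL.2)
    filter_upwards [this] with x hx L hL hwL using hx L ⟨hL, hwL⟩
  obtain ⟨R, hR, hball⟩ := Metric.eventually_nhds_iff_ball.1 (hnear.and (hB.mem_nhds hw))
  set ρ : ℝ := R / (2 * (‖u‖ + 1)) with hρ
  have hρ0 : 0 < ρ := by positivity
  have hρe : ρ * ‖u‖ < R / 2 := by
    have : ρ * (‖u‖ + 1) = R / 2 := by rw [hρ]; field_simp
    nlinarith
  have hmem : ∀ x ∈ ball w (R / 2), ∀ z ∈ closedBall (0 : ℂ) ρ, x + z • u ∈ ball w R := by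
    intro x hx z hz
    rw [mem_ball, dist_eq_norm] at hx ⊢
    rw [mem_closedBall_zero_iff] at hz
    calc ‖x + z • u - w‖ = ‖(x - w) + z • u‖ := by congr 1; abel
      _ ≤ ‖x - w‖ + ‖z‖ * ‖u‖ := (norm_add_le _ _).trans (by rw [norm_smul])
      _ < R := by nlinarith [norm_nonneg u]
  have hcont : ∀ x ∈ ball w (R / 2), ∀ z ∈ closedBall (0 : ℂ) ρ, ContinuousAt J (x + z • u) :=
    fun x hx z hz => (hJ.differentiableAt (hB.mem_nhds (hball _ (hmem x hx z hz)).2)).continuousAt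
  have hw' : w ∈ ball w (R / 2) := mem_ball_self (half_pos hR)
  have hcirc : ∀ z ∈ sphere (0 : ℂ) ρ, J (w + z • u) ≠ 0 := by
    intro z hz
    have hzb := hball _ (hmem w hw' z (sphere_subset_closedBall hz))
    refine hne _ hzb.2 fun L hL hzL => ?_
    by_cases hwL : w ∈ L
    · have hz0 : z ≠ 0 := by
        rintro rfl
        simp at hz
        exact hρ0.ne hz
      exact hu L hL ((L.smul_mem_iff hz0).1 ((L.add_mem_iff_right hwL).1 hzL))
    · exact hzb.1 L hL hwL hzL
  have hcs : IsCompact (sphere (0 : ℂ) ρ) := isCompact_sphere 0 ρ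
  obtain ⟨z₀, hz₀, hmin⟩ := hcs.exists_isMinOn (NormedSpace.sphere_nonempty.2 hρ0.le)
    (f := fun z => ‖J (w + z • u)‖) (fun z hz => by
      refine ContinuousAt.continuousWithinAt ?_
      exact (ContinuousAt.comp (f := fun z : ℂ => w + z • u)
        (hcont w hw' z (sphere_subset_closedBall hz)) (by fun_prop)).norm)
  set c := ‖J (w + z₀ • u)‖ / 2 with hc
  have hpos : 0 < ‖J (w + z₀ • u)‖ := norm_pos_iff.2 (hcirc z₀ hz₀)
  have hc0 : 0 < c := half_pos hpos
  have hunif : ∀ᶠ x in 𝓝 w, ∀ z ∈ sphere (0 : ℂ) ρ, c < ‖J (x + z • u)‖ := by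
    refine hcs.eventually_forall_of_forall_eventually fun z hz => ?_
    have h1 : ContinuousAt (fun p : E × ℂ => ‖J (p.1 + p.2 • u)‖) (w, z) :=
      (ContinuousAt.comp (f := fun p : E × ℂ => p.1 + p.2 • u)
        (hcont w hw' z (sphere_subset_closedBall hz)) (by fun_prop)).norm
    have h2 : c < ‖J (w + z • u)‖ := (half_lt_self hpos).trans_le (hmin hz)
    exact h1.eventually (Ioi_mem_nhds h2)
  intro hJw
  have hsmall : ∀ᶠ x in 𝓝 w, ‖J x‖ < c := by
    have := (hJ.differentiableAt (hB.mem_nhds hw)).continuousAt.norm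
    refine this.eventually (Iio_mem_nhds ?_)
    simpa [hJw] using hc0
  -- Codimension two is used here: `L ⊔ span {u}` is still proper, so there are `x` near `w` whose
  -- line in the direction `u` misses every `L`.
  have hdense := dense_forall_notMem_submodule
    ((fun L : Submodule ℂ E => L ⊔ Submodule.span ℂ {u}) '' S) (hS.image _) (by
      rintro _ ⟨L, hL, rfl⟩ h
      have h1 := hcodim L hL
      have h2 := Submodule.finrank_add_le_finrank_add_finrank L (Submodule.span ℂ {u})
      have h3 : Module.finrank ℂ (Submodule.span ℂ {u}) = 1 := finrank_span_singleton
        (by rintro rfl; exact hu L hL L.zero_mem)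
      simp only at h
      rw [h, finrank_top] at h2
      omega)
  obtain ⟨x, hx, hxc, hxu, hxb⟩ := ((mem_closure_iff_frequently.1 (hdense w)).and_eventually
    (hsmall.and (hunif.and (ball_mem_nhds w (half_pos hR))))).exists
  have hnz : ∀ z ∈ closedBall (0 : ℂ) ρ, J (x + z • u) ≠ 0 := by
    intro z hz
    refine hne _ (hball _ (hmem x hxb z hz)).2 fun L hL hzL => ?_
    refine hx _ ⟨L, hL, rfl⟩ ?_
    have : x = (x + z • u) + (-z) • u := by module
    rw [this]
    exact Submodule.add_mem_sup hzL (Submodule.smul_mem _ _ (Submodule.mem_span_singleton_self u))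
  have hdiff : DifferentiableOn ℂ (fun z : ℂ => (J (x + z • u))⁻¹) (closedBall 0 ρ) := by
    intro z hz
    refine DifferentiableAt.differentiableWithinAt (DifferentiableAt.inv ?_ (hnz z hz))
    exact DifferentiableAt.comp z (hJ.differentiableAt (hB.mem_nhds (hball _ (hmem x hxb z hz)).2))
      (by fun_prop)
  -- The maximum principle for `1 / J` on this disc gives `‖J x‖ ≥ c`, against `J x → J w = 0`.
  have hmax := Complex.norm_le_of_forall_mem_frontier_norm_le (C := c⁻¹)
    (isBounded_ball (x := (0 : ℂ)) (r := ρ)) (hdiff.diffContOnCl_ball subset_rfl)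
    (fun z hz => by
      rw [frontier_ball _ hρ0.ne'] at hz
      rw [norm_inv]
      exact inv_anti₀ hc0 (hxu z hz).le) (z := 0) (subset_closure (mem_ball_self hρ0))
  simp only [zero_smul, add_zero, norm_inv] at hmax
  have hJx : 0 < ‖J x‖ := by
    have := hnz 0 (mem_closedBall_self hρ0.le)
    simpa using this
  exact absurd ((inv_le_inv₀ hJx hc0).1 hmax) (not_le.2 hxc)

end SeveralComplexVariablesExtension

namespace FiniteQuotient

/-! ### Isotropy groups, pseudoreflections and the codimension-one strata. -/

section Isotropy

variable {V : Type*} [NormedAddCommGroup V] [NormedSpace ℂ V]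

/-- The subspace of vectors fixed by the isotropy group of `v`. -/
def isotropySubspace (G : Subgroup (V ≃ₗ[ℂ] V)) (v : V) : Submodule ℂ V where
  carrier := {x | ∀ g ∈ MulAction.stabilizer G v, g • x = x}
  add_mem' {a b} ha hb g hg := by rw [smul_add, ha g hg, hb g hg]
  zero_mem' g _ := smul_zero g
  smul_mem' c x hx g hg := by
    have h := hx g hg
    change (g : V ≃ₗ[ℂ] V) (c • x) = c • x
    rw [map_smul]
    exact congrArg (c • ·) h

/-- The isotropy group of `v` fixes a hyperplane pointwise. -/
def FixesHyperplane (G : Subgroup (V ≃ₗ[ℂ] V)) (v : V) : Prop :=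
  Module.finrank ℂ V ≤ Module.finrank ℂ (isotropySubspace G v) + 1

variable (G : Subgroup (V ≃ₗ[ℂ] V))

theorem mem_isotropySubspace_self (v : V) : v ∈ isotropySubspace G v := fun _ hg => hg

theorem coe_smul_apply (g : G) (v : V) : g • v = (g : V ≃ₗ[ℂ] V) v := rfl

theorem proj_eq_proj_iff {v w : V} : proj G v = proj G w ↔ ∃ g : G, v = g • w := by
  unfold proj
  rw [Quotient.eq, MulAction.orbitRel_apply, MulAction.mem_orbit_iff]
  exact ⟨fun ⟨g, h⟩ => ⟨g, h.symm⟩, fun ⟨g, h⟩ => ⟨g, h.symm⟩⟩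

theorem proj_smul (g : G) (v : V) : proj G (g • v) = proj G v :=
  (proj_eq_proj_iff G).2 ⟨g, rfl⟩

theorem finite_range_isotropySubspace [Finite G] : (range (isotropySubspace G)).Finite := by
  have : range (isotropySubspace G) ⊆ range (fun K : Subgroup G =>
      (⨅ g ∈ K, LinearMap.ker (((g : V ≃ₗ[ℂ] V) : V →ₗ[ℂ] V) - LinearMap.id))) := by
    rintro _ ⟨v, rfl⟩
    refine ⟨MulAction.stabilizer G v, ?_⟩
    ext x
    simp only [Submodule.mem_iInf, LinearMap.mem_ker, LinearMap.sub_apply, LinearMap.id_apply,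
      sub_eq_zero]
    rfl
  exact (finite_range _).subset this

variable {G}

theorem FixesHyperplane.smul [FiniteDimensional ℂ V] {v : V} (hv : FixesHyperplane G v) (g : G) :
    FixesHyperplane G (g • v) := by
  have hle : (isotropySubspace G v).map ((g : V ≃ₗ[ℂ] V) : V →ₗ[ℂ] V) ≤
      isotropySubspace G (g • v) := by
    rintro _ ⟨x, hx, rfl⟩ k hk
    have h1 : (g⁻¹ * k * g) • x = x := by
      refine hx _ ?_
      rw [MulAction.mem_stabilizer_iff] at hk ⊢
      rw [mul_smul, mul_smul, hk, inv_smul_smul]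
    have h2 : k • (g • x) = g • x := by
      rw [mul_smul, mul_smul, inv_smul_eq_iff] at h1
      exact h1
    exact h2
  have h := Submodule.finrank_mono hle
  rw [LinearEquiv.finrank_map_eq] at h
  unfold FixesHyperplane at hv ⊢
  omega

theorem card_stabilizer_smul (g : G) (v : V) :
    Nat.card (MulAction.stabilizer G (g • v)) = Nat.card (MulAction.stabilizer G v) := by
  rw [MulAction.stabilizer_smul_eq_stabilizer_map_conj]
  exact (Nat.card_congr
    ((MulAction.stabilizer G v).equivMapOfInjective _ (MulAut.conj g).injective).toEquiv).symm

/-- A non-trivial isotropy group that fixes a hyperplane pointwise is generated by a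
pseudoreflection. -/
theorem FixesHyperplane.exists_generator [FiniteDimensional ℂ V] [Finite G] {v : V}
    (hv : FixesHyperplane G v) (hne : MulAction.stabilizer G v ≠ ⊥) :
    ∃ (g : G) (l : V →ₗ[ℂ] ℂ) (e : V) (ξ : ℂ), MulAction.stabilizer G v = Subgroup.zpowers g ∧
      l e = 1 ∧ LinearMap.ker l = isotropySubspace G v ∧ IsPrimitiveRoot ξ (orderOf g) ∧
      1 < orderOf g ∧ ∀ x, g • x = x + ((ξ - 1) * l x) • e := by
  set K := MulAction.stabilizer G v with hK
  set T := isotropySubspace G v with hT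
  have hTtop : T ≠ ⊤ := by
    intro h
    refine hne (eq_bot_iff.2 fun k hk => ?_)
    rw [Subgroup.mem_bot]
    ext x
    have hx : x ∈ T := by rw [h]; trivial
    exact hx k hk
  obtain ⟨l, hl0, hTl⟩ := Submodule.exists_le_ker_of_lt_top T (lt_top_iff_ne_top.2 hTtop)
  have hker : LinearMap.ker l = T := by
    refine (Submodule.eq_of_le_of_finrank_le hTl ?_).symm
    have h1 : LinearMap.ker l ≠ ⊤ := fun h => hl0 (LinearMap.ker_eq_top.1 h)
    have h2 := Submodule.finrank_lt h1
    have h3 : Module.finrank ℂ V ≤ Module.finrank ℂ T + 1 := hv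
    omega
  obtain ⟨e₀, he₀⟩ : ∃ e, l e = 1 := by
    obtain ⟨y, hy⟩ : ∃ y, l y ≠ 0 := by
      by_contra! h
      exact hl0 (LinearMap.ext h)
    exact ⟨(l y)⁻¹ • y, by simp [hy]⟩
  have hact : ∀ k ∈ K, ∀ x, k • x = x + l x • (k • e₀ - e₀) := by
    intro k hk x
    have h1 : x - l x • e₀ ∈ T := by
      rw [← hker, LinearMap.mem_ker]
      simp [he₀]
    have h2 : k • (x - l x • e₀) = x - l x • e₀ := h1 k hk
    have h3 : k • (x - l x • e₀) = k • x - l x • (k • e₀) := by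
      simp only [coe_smul_apply, map_sub, map_smul]
    rw [h3] at h2
    rw [smul_sub, ← sub_eq_zero]
    rw [← sub_eq_zero] at h2
    rw [← h2]
    generalize k • x = a
    generalize k • e₀ = b
    module
  have hχ : ∀ k ∈ K, ∀ x, l (k • x) = l x * l (k • e₀) := by
    intro k hk x
    rw [hact k hk x, map_add, map_smul, map_sub, he₀, smul_eq_mul]
    ring
  -- The character by which `K` acts on the line `V / T`, read off through `l`.
  let χ : K →* ℂ :=
    { toFun := fun k => l ((k : G) • e₀)
      map_one' := by simp [he₀]
      map_mul' := fun a b => by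
        simp only [Subgroup.coe_mul, mul_smul]
        rw [hχ a a.2 ((b : G) • e₀), mul_comm] }
  have hpow : ∀ k ∈ K, l (k • e₀) = 1 → ∀ (n : ℕ) (x : V),
      k ^ n • x = x + (n : ℂ) • l x • (k • e₀ - e₀) := by
    intro k hk h1 n
    induction n with
    | zero => simp
    | succ n ih =>
      intro x
      rw [pow_succ, mul_smul, ih (k • x), hχ k hk, h1, mul_one, hact k hk x]
      generalize k • e₀ = b
      push_cast
      module
  -- An element of the kernel is a transvection, whose `n`-th power translates by `n` times a fixed
  -- vector; having finite order, it is trivial. So `K` embeds in `ℂ` and is cyclic.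
  have hχinj : Function.Injective χ := by
    rw [injective_iff_map_eq_one]
    intro k hk1
    have hk1' : l ((k : G) • e₀) = 1 := hk1
    have h2 := hpow k k.2 hk1' (orderOf (k : G)) e₀
    rw [pow_orderOf_eq_one, one_smul, he₀, one_smul, left_eq_add, smul_eq_zero] at h2
    have h3 : (k : G) • e₀ - e₀ = 0 :=
      h2.resolve_left (Nat.cast_ne_zero.2 (orderOf_pos _).ne')
    ext x
    have h4 := hact k k.2 x
    rw [h3, smul_zero, add_zero] at h4
    exact h4
  have hcyc : IsCyclic K := isCyclic_of_injective_ringHom χ hχinj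
  obtain ⟨g, hg⟩ := hcyc.exists_generator
  have hgen : K = Subgroup.zpowers (g : G) := by
    refine le_antisymm (fun k hk => ?_) ((Subgroup.zpowers_le).2 g.2)
    obtain ⟨n, hn⟩ := Subgroup.mem_zpowers_iff.1 (hg ⟨k, hk⟩)
    exact Subgroup.mem_zpowers_iff.2 ⟨n, by rw [← Subgroup.coe_zpow, hn]⟩
  have hg1 : (g : G) ≠ 1 := by
    intro h
    rw [h, Subgroup.zpowers_one_eq_bot] at hgen
    exact hne hgen
  set ξ : ℂ := l ((g : G) • e₀) with hξ
  have hprim : IsPrimitiveRoot ξ (orderOf (g : G)) := by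
    rw [Subgroup.orderOf_coe]
    have h1 : ξ = χ g := rfl
    refine ⟨by rw [h1, ← map_pow, pow_orderOf_eq_one, map_one], fun n hn => ?_⟩
    rw [h1, ← map_pow, ← map_one χ] at hn
    exact orderOf_dvd_of_pow_eq_one (hχinj hn)
  have hord : 1 < orderOf (g : G) := by
    have h1 := orderOf_pos (g : G)
    have h2 : orderOf (g : G) ≠ 1 := fun h => hg1 (orderOf_eq_one_iff.1 h)
    omega
  have hξ1 : ξ - 1 ≠ 0 := sub_ne_zero.2 (hprim.ne_one hord)
  -- The vector `g • e₀ - e₀` spans the `ξ`-eigenline of `g`; the factor normalises `l e = 1`.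
  refine ⟨g, l, (ξ - 1)⁻¹ • ((g : G) • e₀ - e₀), ξ, hgen, ?_, hker, hprim, hord, fun x => ?_⟩
  · rw [map_smul, map_sub, he₀, smul_eq_mul, ← hξ, inv_mul_cancel₀ hξ1]
  · rw [hact g g.2 x, smul_smul]
    congr 2
    field_simp

theorem pow_smul_eq_of_reflection {g : G} {l : V →ₗ[ℂ] ℂ} {e : V} {ξ : ℂ} (he : l e = 1)
    (hg : ∀ x, g • x = x + ((ξ - 1) * l x) • e) (n : ℕ) (x : V) :
    g ^ n • x = x + ((ξ ^ n - 1) * l x) • e := by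
  induction n generalizing x with
  | zero => simp
  | succ n ih =>
    rw [pow_succ, mul_smul, ih, hg, map_add, map_smul, he]
    simp only [smul_eq_mul, mul_one]
    module

theorem apply_eq_zero_of_pow_smul_eq {g : G} {l : V →ₗ[ℂ] ℂ} {e : V} {ξ : ℂ} (he : l e = 1)
    (hg : ∀ x, g • x = x + ((ξ - 1) * l x) • e) (hξ : IsPrimitiveRoot ξ (orderOf g)) {n : ℕ}
    (hn : g ^ n ≠ 1) {x : V} (hx : g ^ n • x = x) : l x = 0 := by
  rw [pow_smul_eq_of_reflection he hg, add_eq_left, smul_eq_zero, mul_eq_zero, sub_eq_zero] at hx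
  rcases hx with (h | h) | h
  · exact absurd (orderOf_dvd_iff_pow_eq_one.1 (hξ.dvd_of_pow_eq_one n h)) hn
  · exact h
  · rw [h, map_zero] at he
    exact absurd he zero_ne_one

/-- Every non-trivial element of an isotropy group that fixes a hyperplane pointwise has the same
fixed points. -/
theorem FixesHyperplane.mem_isotropySubspace [FiniteDimensional ℂ V] [Finite G] {v : V}
    (hv : FixesHyperplane G v) {k : G} (hk : k ∈ MulAction.stabilizer G v) (hk1 : k ≠ 1) {x : V}
    (hx : k • x = x) : x ∈ isotropySubspace G v := by
  have hne : MulAction.stabilizer G v ≠ ⊥ := by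
    intro h
    rw [h, Subgroup.mem_bot] at hk
    exact hk1 hk
  obtain ⟨g, l, e, ξ, hgen, he, hker, hξ, -, hg⟩ := hv.exists_generator hne
  rw [hgen] at hk
  obtain ⟨n, rfl⟩ : ∃ n : ℕ, g ^ n = k :=
    (Submonoid.mem_powers_iff _ _).1 (mem_powers_iff_mem_zpowers.2 hk)
  rw [← hker]
  exact apply_eq_zero_of_pow_smul_eq he hg hξ hk1 hx

theorem fixesHyperplane_of_isPseudoreflection [FiniteDimensional ℂ V] {v : V} {g : G}
    (hg : IsPseudoreflection (g : V ≃ₗ[ℂ] V))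
    (hv : MulAction.stabilizer G v = Subgroup.zpowers g) : FixesHyperplane G v := by
  have hle : LinearMap.ker (((g : V ≃ₗ[ℂ] V) : V →ₗ[ℂ] V) - LinearMap.id) ≤
      isotropySubspace G v := by
    intro x hx k hk
    have hx' : g ∈ MulAction.stabilizer G x := by
      rw [LinearMap.mem_ker, LinearMap.sub_apply, sub_eq_zero] at hx
      exact hx
    rw [hv] at hk
    exact (Subgroup.zpowers_le.2 hx') hk
  have h := Submodule.finrank_mono hle
  unfold IsPseudoreflection at hg
  unfold FixesHyperplane
  omega

theorem IsPseudoreflection.ne_one {g : G} (hg : IsPseudoreflection (g : V ≃ₗ[ℂ] V)) : g ≠ 1 := by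
  rintro rfl
  unfold IsPseudoreflection at hg
  have : ((((1 : G) : V ≃ₗ[ℂ] V) : V →ₗ[ℂ] V) - LinearMap.id) = 0 := by ext x; simp
  rw [this, LinearMap.ker_zero, finrank_top] at hg
  omega

theorem FixesHyperplane.exists_isCodimOneStratum [FiniteDimensional ℂ V] [Finite G] {v : V}
    (hv : FixesHyperplane G v) (hne : MulAction.stabilizer G v ≠ ⊥) :
    ∃ C, IsCodimOneStratum G C (Nat.card (MulAction.stabilizer G v)) ∧ proj G v ∈ C := by
  obtain ⟨g, l, e, ξ, hgen, he, hker, hξ, hord, hg⟩ := hv.exists_generator hne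
  have hmem : v ∈ isotropyGeneratedBy G g := hgen
  refine ⟨proj G '' isotropyGeneratedBy G g, ⟨⟨_, v, hmem, rfl⟩, g, ?_, ?_, rfl⟩, v, hmem, rfl⟩
  · have h1 : LinearMap.ker (((g : V ≃ₗ[ℂ] V) : V →ₗ[ℂ] V) - LinearMap.id) = LinearMap.ker l := by
      ext x
      have h2 : (((g : V ≃ₗ[ℂ] V) : V →ₗ[ℂ] V) - LinearMap.id : V →ₗ[ℂ] V) x = ((ξ - 1) * l x) • e := by
        have := hg x
        rw [coe_smul_apply] at this
        simp [this]
      have he0 : e ≠ 0 := by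
        rintro rfl
        simp at he
      rw [LinearMap.mem_ker, h2, LinearMap.mem_ker, smul_eq_zero, mul_eq_zero]
      have := sub_ne_zero.2 (hξ.ne_one hord)
      tauto
    unfold IsPseudoreflection
    rw [h1]
    have h3 := LinearMap.finrank_range_add_finrank_ker l
    have h4 : LinearMap.range l = ⊤ := LinearMap.range_eq_top.2 fun c => ⟨c • e, by simp [he]⟩
    rw [h4, finrank_top, Module.finrank_self] at h3
    omega
  · rw [hgen, Nat.card_zpowers]

instance [FiniteDimensional ℂ V] : ContinuousConstSMul G V :=
  ⟨fun g => LinearMap.continuous_of_finiteDimensional ((g : V ≃ₗ[ℂ] V) : V →ₗ[ℂ] V)⟩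

theorem continuous_proj : Continuous (proj G) := continuous_quot_mk

theorem isOpenMap_proj [FiniteDimensional ℂ V] : IsOpenMap (proj G) := by
  exact isOpenMap_quotient_mk'_mul (Γ := G) (T := V)

theorem isClosed_image_proj [FiniteDimensional ℂ V] [Finite G] {A : Set V} (hA : IsClosed A) :
    IsClosed (proj G '' A) := by
  have hq : IsQuotientMap (proj G) := isQuotientMap_quotient_mk'
  rw [← hq.isClosed_preimage]
  have : proj G ⁻¹' (proj G '' A) = ⋃ g : G, (fun x : V => g • x) ⁻¹' A := by
    ext x
    simp only [mem_preimage, mem_image, mem_iUnion, proj_eq_proj_iff]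
    constructor
    · rintro ⟨y, hy, g, rfl⟩
      exact ⟨g, hy⟩
    · rintro ⟨g, hg⟩
      exact ⟨_, hg, g, rfl⟩
  rw [this]
  exact isClosed_iUnion_of_finite fun g => hA.preimage (continuous_const_smul g)

theorem closure_image_isotropyGeneratedBy_subset [FiniteDimensional ℂ V] [Finite G] (g : G) :
    closure (proj G '' isotropyGeneratedBy G g) ⊆ proj G '' {x | g • x = x} := by
  refine closure_minimal (image_mono fun x hx => ?_)
    (isClosed_image_proj (isClosed_eq (continuous_const_smul g) continuous_id))
  have : g ∈ MulAction.stabilizer G x := by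
    rw [show MulAction.stabilizer G x = Subgroup.zpowers g from hx]
    exact Subgroup.mem_zpowers g
  exact this

/-- A translate `a • v` is fixed by `g`. As its isotropy fixes a hyperplane, it fixes every fixed
point of `g`, in particular a point `x₀` with isotropy exactly `⟨g⟩`, so it equals `⟨g⟩`. This
recovers strata from their closures, the only thing `f` is assumed to respect. -/
theorem FixesHyperplane.mem_stratum_of_mem_closure [FiniteDimensional ℂ V] [Finite G] {v : V}
    (hv : FixesHyperplane G v) {C : Set (OrbitSpace G)} {r : ℕ} (hC : IsCodimOneStratum G C r)
    (hvC : proj G v ∈ closure C) : proj G v ∈ C ∧ Nat.card (MulAction.stabilizer G v) = r := by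
  obtain ⟨hne, g, hg, rfl, rfl⟩ := hC
  obtain ⟨_, x₀, hx₀, -⟩ := hne
  obtain ⟨y, hy, hyv⟩ := closure_image_isotropyGeneratedBy_subset g hvC
  obtain ⟨a, rfl⟩ := (proj_eq_proj_iff G).1 hyv
  have hav : FixesHyperplane G (a • v) := hv.smul a
  have hgstab : g ∈ MulAction.stabilizer G (a • v) := hy
  have hx₀' : g • x₀ = x₀ := by
    have : g ∈ MulAction.stabilizer G x₀ := by
      rw [show MulAction.stabilizer G x₀ = Subgroup.zpowers g from hx₀]
      exact Subgroup.mem_zpowers g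
    exact this
  have hx₀T := hav.mem_isotropySubspace hgstab hg.ne_one hx₀'
  have heq : MulAction.stabilizer G (a • v) = Subgroup.zpowers g := by
    refine le_antisymm (fun k hk => ?_) (Subgroup.zpowers_le.2 hgstab)
    rw [← show MulAction.stabilizer G x₀ = Subgroup.zpowers g from hx₀]
    exact hx₀T k hk
  refine ⟨⟨a • v, heq, proj_smul G a v⟩, ?_⟩
  rw [← card_stabilizer_smul a v, heq, Nat.card_zpowers]

theorem IsCodimOneStratum.exists_fixesHyperplane [FiniteDimensional ℂ V]
    {C : Set (OrbitSpace G)} {r : ℕ} (hC : IsCodimOneStratum G C r) {y : OrbitSpace G}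
    (hy : y ∈ C) : ∃ v, FixesHyperplane G v ∧ proj G v = y ∧
      Nat.card (MulAction.stabilizer G v) = r := by
  obtain ⟨-, g, hg, rfl, rfl⟩ := hC
  obtain ⟨v, hv, rfl⟩ := hy
  refine ⟨v, fixesHyperplane_of_isPseudoreflection hg hv, rfl, ?_⟩
  rw [show MulAction.stabilizer G v = Subgroup.zpowers g from hv, Nat.card_zpowers]

theorem IsCodimOneStratum.subset_of_closure_subset [FiniteDimensional ℂ V] [Finite G]
    {C C' : Set (OrbitSpace G)} {r r' : ℕ} (hC : IsCodimOneStratum G C r)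
    (hC' : IsCodimOneStratum G C' r') (h : C ⊆ closure C') : C ⊆ C' := by
  intro y hy
  obtain ⟨v, hv, rfl, -⟩ := hC.exists_fixesHyperplane hy
  exact (hv.mem_stratum_of_mem_closure hC' (h hy)).1

theorem IsCodimOneStratum.order_unique [FiniteDimensional ℂ V] [Finite G]
    {C : Set (OrbitSpace G)} {r r' : ℕ} (hC : IsCodimOneStratum G C r)
    (hC' : IsCodimOneStratum G C r') : r = r' := by
  obtain ⟨y, hy⟩ := hC.1
  obtain ⟨v, hv, rfl, hr⟩ := hC.exists_fixesHyperplane hy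
  rw [← hr, (hv.mem_stratum_of_mem_closure hC' (subset_closure hy)).2]

theorem finite_codimOneStrata [Finite G] : (codimOneStrata G).Finite := by
  refine (finite_range fun g : G => proj G '' isotropyGeneratedBy G g).subset ?_
  rintro C ⟨r, -, g, -, -, rfl⟩
  exact ⟨g, rfl⟩

theorem eventually_stabilizer_le [FiniteDimensional ℂ V] [Finite G] (v : V) :
    ∀ᶠ x in 𝓝 v, MulAction.stabilizer G x ≤ MulAction.stabilizer G v := by
  have h : ∀ g : G, ∀ᶠ x in 𝓝 v, g • x = x → g • v = v := by
    intro g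
    by_cases hg : g • v = v
    · exact Eventually.of_forall fun _ _ => hg
    · have := (isOpen_ne_fun (continuous_const_smul g) continuous_id).mem_nhds
        (show v ∈ {x : V | g • x ≠ id x} from hg)
      filter_upwards [this] with x hx h
      exact absurd h hx
  filter_upwards [eventually_all.2 h] with x hx g hg using hx g hg

theorem FixesHyperplane.of_stabilizer_le [FiniteDimensional ℂ V] {v x : V}
    (hv : FixesHyperplane G v) (h : MulAction.stabilizer G x ≤ MulAction.stabilizer G v) :
    FixesHyperplane G x := by
  have hle : isotropySubspace G v ≤ isotropySubspace G x := fun y hy k hk => hy k (h hk)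
  have := Submodule.finrank_mono hle
  unfold FixesHyperplane at hv ⊢
  omega

theorem FixesHyperplane.eventually [FiniteDimensional ℂ V] [Finite G] {v : V}
    (hv : FixesHyperplane G v) : ∀ᶠ x in 𝓝 v, FixesHyperplane G x :=
  (eventually_stabilizer_le v).mono fun _ hx => hv.of_stabilizer_le hx

theorem finrank_isotropySubspace_add_two_le {v : V} (hv : ¬ FixesHyperplane G v) :
    Module.finrank ℂ (isotropySubspace G v) + 2 ≤ Module.finrank ℂ V := by
  unfold FixesHyperplane at hv
  omega

end Isotropy

end FiniteQuotient

namespace FiniteQuotient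

/-! ### Invariants of an isotropy group as holomorphic germs on the quotient. -/

section Germs

variable {V : Type*} [NormedAddCommGroup V] [NormedSpace ℂ V]

theorem linear_mem_polynomialFunctions (l : V →ₗ[ℂ] ℂ) :
    (fun x => l x) ∈ polynomialFunctions V :=
  Algebra.subset_adjoin ⟨l, rfl⟩

theorem const_mem_polynomialFunctions (c : ℂ) : (fun _ : V => c) ∈ polynomialFunctions V :=
  (polynomialFunctions V).algebraMap_mem c

theorem comp_mem_polynomialFunctions {p : V → ℂ} (hp : p ∈ polynomialFunctions V)
    (L : V →ₗ[ℂ] V) : (fun x => p (L x)) ∈ polynomialFunctions V := by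
  unfold polynomialFunctions at hp
  induction hp using Algebra.adjoin_induction with
  | mem p hp =>
    obtain ⟨l, rfl⟩ := hp
    exact linear_mem_polynomialFunctions (l ∘ₗ L)
  | algebraMap c => exact const_mem_polynomialFunctions c
  | add p q _ _ hp hq => exact add_mem hp hq
  | mul p q _ _ hp hq => exact mul_mem hp hq

theorem analyticAt_of_mem_polynomialFunctions [FiniteDimensional ℂ V] {p : V → ℂ}
    (hp : p ∈ polynomialFunctions V) (x : V) : AnalyticAt ℂ p x := by
  unfold polynomialFunctions at hp
  induction hp using Algebra.adjoin_induction with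
  | mem p hp =>
    obtain ⟨l, rfl⟩ := hp
    exact (LinearMap.toContinuousLinearMap l).analyticAt x
  | algebraMap c => exact analyticAt_const
  | add p q _ _ hp hq => exact hp.add hq
  | mul p q _ _ hp hq => exact hp.mul hq

theorem exists_polynomialFunction_interpolating (v : V) (S : Finset V) (hv : v ∉ S) :
    ∃ t ∈ polynomialFunctions V, t v = 1 ∧ ∀ y ∈ S, t y = 0 := by
  classical
  induction S using Finset.induction_on with
  | empty => exact ⟨fun _ => 1, const_mem_polynomialFunctions 1, rfl, by simp⟩
  | insert y S _ ih =>
    rw [Finset.mem_insert, not_or] at hv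
    obtain ⟨t, ht, htv, htS⟩ := ih hv.2
    obtain ⟨l, hl⟩ : ∃ l : Module.Dual ℂ V, l (v - y) ≠ 0 := by
      by_contra! h
      exact hv.1 (sub_eq_zero.1 ((Module.forall_dual_apply_eq_zero_iff ℂ _).1 h))
    have hl' : l v - l y ≠ 0 := by rwa [map_sub] at hl
    refine ⟨fun x => t x * ((l x - l y) * (l v - l y)⁻¹), ?_, ?_, ?_⟩
    · exact mul_mem ht (mul_mem (sub_mem (linear_mem_polynomialFunctions l)
        (const_mem_polynomialFunctions _)) (const_mem_polynomialFunctions _))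
    · simp [htv, hl']
    · intro z hz
      rcases Finset.mem_insert.1 hz with rfl | hz
      · simp
      · simp [htS z hz]

variable {G : Subgroup (V ≃ₗ[ℂ] V)}

/-- Average over the isotropy group a polynomial that is `1` at `v` and `0` at the other points of
the orbit. -/
theorem exists_separating_invariant [Finite G] (v : V) :
    ∃ s ∈ polynomialFunctions V, (∀ k ∈ MulAction.stabilizer G v, ∀ x, s (k • x) = s x) ∧
      s v ≠ 0 ∧ ∀ g ∉ MulAction.stabilizer G v, s (g • v) = 0 := by
  classical
  set K := MulAction.stabilizer G v with hK
  have := Fintype.ofFinite G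
  have := Fintype.ofFinite K
  obtain ⟨t, ht, htv, htS⟩ := exists_polynomialFunction_interpolating v
    ((Finset.univ.image fun g : G => g • v).erase v) (by simp)
  have hzero : ∀ g ∉ K, t (g • v) = 0 := fun g hg => htS _ (by
    simp only [Finset.mem_erase, Finset.mem_image, Finset.mem_univ, true_and]
    exact ⟨hg, g, rfl⟩)
  refine ⟨fun x => ∑ k : K, t ((k : G) • x), ?_, ?_, ?_, ?_⟩
  · have : (fun x => ∑ k : K, t ((k : G) • x)) = ∑ k : K, fun x => t ((k : G) • x) := by
      ext x; simp
    rw [this]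
    exact sum_mem fun k _ => comp_mem_polynomialFunctions ht (((k : G) : V ≃ₗ[ℂ] V) : V →ₗ[ℂ] V)
  · intro k hk x
    simp only [← mul_smul]
    exact Fintype.sum_equiv (Equiv.mulRight (⟨k, hk⟩ : K)) _ _ (fun a => by simp)
  · have : ∀ k : K, t ((k : G) • v) = 1 := fun k => by
      rw [show (k : G) • v = v from k.2, htv]
    simp [this]
  · intro g hg
    refine Finset.sum_eq_zero fun k _ => ?_
    rw [← mul_smul]
    exact hzero _ fun h => hg ((K.mul_mem_cancel_left k.2).1 h)

theorem IsHolomorphicAt.analyticAt_comp_proj [FiniteDimensional ℂ V] {φ : OrbitSpace G → ℂ}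
    {v : V} (h : IsHolomorphicAt G φ (proj G v)) : AnalyticAt ℂ (φ ∘ proj G) v := by
  obtain ⟨m, p, h, hp, han, heq⟩ := h
  have h1 : AnalyticAt ℂ (fun x => h (fun i => p i (proj G x))) v :=
    AnalyticAt.comp (g := h) (f := fun x => fun i => p i (proj G x)) han
      (AnalyticAt.pi fun i => analyticAt_of_mem_polynomialFunctions (hp i) v)
  refine h1.congr ?_
  have := (continuous_proj (G := G)).continuousAt.eventually heq
  filter_upwards [this] with x hx using hx.symm

/-- A simple root depends holomorphically on the coefficients: invert `(c, t) ↦ (c, ∑ c j * t ^ j)`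
near `(c₀, t₀)` and restrict the inverse to `(c, 0)`. -/
theorem exists_analyticAt_simple_root {N : ℕ} (c₀ : Fin (N + 1) → ℂ) (t₀ : ℂ)
    (h0 : ∑ j, c₀ j * t₀ ^ (j : ℕ) = 0) {d : ℂ} (hd : d ≠ 0)
    (hderiv : HasDerivAt (fun t : ℂ => ∑ j, c₀ j * t ^ (j : ℕ)) d t₀) :
    ∃ h : (Fin (N + 1) → ℂ) → ℂ, AnalyticAt ℂ h c₀ ∧
      ∀ᶠ p : (Fin (N + 1) → ℂ) × ℂ in 𝓝 (c₀, t₀),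
        ∑ j, p.1 j * p.2 ^ (j : ℕ) = 0 → h p.1 = p.2 := by
  set P : (Fin (N + 1) → ℂ) × ℂ → ℂ := fun p => ∑ j, p.1 j * p.2 ^ (j : ℕ) with hP
  set A : (Fin (N + 1) → ℂ) × ℂ → (Fin (N + 1) → ℂ) × ℂ := fun p => (p.1, P p) with hA
  have hPan : AnalyticAt ℂ P (c₀, t₀) := by
    refine Finset.analyticAt_fun_sum _ fun j _ => ?_
    refine AnalyticAt.mul ?_ (analyticAt_snd.pow _)
    exact ((ContinuousLinearMap.proj (R := ℂ) (φ := fun _ : Fin (N + 1) => ℂ) j).comp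
      (ContinuousLinearMap.fst ℂ (Fin (N + 1) → ℂ) ℂ)).analyticAt _
  have hAan : AnalyticAt ℂ A (c₀, t₀) := analyticAt_fst.prod hPan
  set A' := fderiv ℂ A (c₀, t₀) with hA'
  have hA'eq : A' = (ContinuousLinearMap.fst ℂ (Fin (N + 1) → ℂ) ℂ).prod
      (fderiv ℂ P (c₀, t₀)) :=
    (hasFDerivAt_fst.prodMk hPan.differentiableAt.hasFDerivAt).fderiv
  have hPd : fderiv ℂ P (c₀, t₀) (0, 1) = d := by
    have h1 : HasDerivAt (fun t : ℂ => (c₀, t)) ((0 : Fin (N + 1) → ℂ), (1 : ℂ)) t₀ :=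
      (hasDerivAt_const t₀ c₀).prodMk (hasDerivAt_id t₀)
    have h2 := hPan.differentiableAt.hasFDerivAt.comp_hasDerivAt t₀ h1
    exact h2.unique hderiv
  have hinj : Function.Injective (A' : (Fin (N + 1) → ℂ) × ℂ →ₗ[ℂ] (Fin (N + 1) → ℂ) × ℂ) := by
    rw [← LinearMap.ker_eq_bot, LinearMap.ker_eq_bot']
    rintro ⟨a, b⟩ hab
    have hab' : A' (a, b) = 0 := hab
    rw [hA'eq, ContinuousLinearMap.prod_apply, Prod.mk_eq_zero] at hab'
    obtain ⟨ha, hb⟩ := hab'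
    have ha' : a = 0 := ha
    subst ha'
    have : ((0 : Fin (N + 1) → ℂ), b) = b • ((0 : Fin (N + 1) → ℂ), (1 : ℂ)) := by simp
    rw [this, map_smul, hPd, smul_eq_mul, mul_eq_zero] at hb
    rw [hb.resolve_right hd]
    rfl
  set i := (LinearEquiv.ofInjectiveEndo _ hinj).toContinuousLinearEquiv with hi
  have hi' : A' = (i : (Fin (N + 1) → ℂ) × ℂ →L[ℂ] (Fin (N + 1) → ℂ) × ℂ) := by
    ext x <;> rfl
  have hAf : HasFDerivAt A (i : (Fin (N + 1) → ℂ) × ℂ →L[ℂ] (Fin (N + 1) → ℂ) × ℂ) (c₀, t₀) := by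
    rw [← hi']
    exact hAan.differentiableAt.hasFDerivAt
  set Φ := (hAan.contDiffAt (n := 1)).toOpenPartialHomeomorph A hAf one_ne_zero with hΦ
  have hΦA : (Φ : (Fin (N + 1) → ℂ) × ℂ → (Fin (N + 1) → ℂ) × ℂ) = A := rfl
  have hsrc : (c₀, t₀) ∈ Φ.source :=
    (hAan.contDiffAt (n := 1)).mem_toOpenPartialHomeomorph_source hAf one_ne_zero
  have hsymm : AnalyticAt ℂ Φ.symm (A (c₀, t₀)) :=
    Φ.analyticAt_symm' hsrc hAan hi'
  have hAc : A (c₀, t₀) = (c₀, 0) := by simp only [hA, hP, h0]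
  rw [hAc] at hsymm
  refine ⟨fun c => (Φ.symm (c, 0)).2, ?_, ?_⟩
  · have h1 : AnalyticAt ℂ (fun c : Fin (N + 1) → ℂ => (c, (0 : ℂ))) c₀ :=
      analyticAt_id.prod analyticAt_const
    exact analyticAt_snd.comp (AnalyticAt.comp (f := fun c : Fin (N + 1) → ℂ => (c, (0 : ℂ)))
      (g := Φ.symm) hsymm h1)
  · filter_upwards [Φ.open_source.mem_nhds hsrc] with p hp hp0
    have h1 := Φ.left_inv hp
    have h2 : Φ p = (p.1, 0) := by
      rw [hΦA]
      simp only [hA, hP, hp0]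
    rw [h2] at h1
    simp only [h1]

/-- A polynomial that is invariant under the isotropy group of `v` and separates `v` from the other
points of its orbit induces a holomorphic germ on the quotient. -/
theorem exists_isHolomorphicAt_of_separating [FiniteDimensional ℂ V] [Finite G] (v : V) {q : V → ℂ}
    (hq : q ∈ polynomialFunctions V)
    (hinv : ∀ k ∈ MulAction.stabilizer G v, ∀ x, q (k • x) = q x)
    (hsep : ∀ g ∉ MulAction.stabilizer G v, q (g • v) ≠ q v) :
    ∃ ψ : OrbitSpace G → ℂ, IsHolomorphicAt G ψ (proj G v) ∧
      ∀ᶠ x in 𝓝 v, ψ (proj G x) = q x := by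
  classical
  set K := MulAction.stabilizer G v with hK
  have := Fintype.ofFinite (G ⧸ K)
  -- The translates of `q`, indexed by cosets because `q` is `K`-invariant.
  let Q : G ⧸ K → polynomialFunctions V := fun c =>
    ⟨fun x => q (c.out⁻¹ • x), comp_mem_polynomialFunctions hq
      (((c.out⁻¹ : G) : V ≃ₗ[ℂ] V) : V →ₗ[ℂ] V)⟩
  have hQmk : ∀ (a : G) (x : V), (Q (a : G ⧸ K) : V → ℂ) x = q (a⁻¹ • x) := by
    intro a x
    obtain ⟨k, hk⟩ := QuotientGroup.mk_out_eq_mul K a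
    change q ((Quotient.out (a : G ⧸ K))⁻¹ • x) = _
    rw [hk, mul_inv_rev, mul_smul]
    exact hinv _ (K.inv_mem k.2) _
  have hQsmul : ∀ (h : G) (c : G ⧸ K) (x : V),
      (Q c : V → ℂ) (h • x) = (Q (h⁻¹ • c) : V → ℂ) x := by
    intro h c x
    induction c using QuotientGroup.induction_on with
    | H a =>
      rw [hQmk]
      have : h⁻¹ • (a : G ⧸ K) = ((h⁻¹ * a : G) : G ⧸ K) := rfl
      rw [this, hQmk, mul_inv_rev, inv_inv, mul_smul]
  -- `G` permutes the factors, so the coefficients of `P` are `G`-invariant and descend to regular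
  -- functions, while `q` itself is a root.
  let P : Polynomial (polynomialFunctions V) := ∏ c, (Polynomial.X - Polynomial.C (Q c))
  let ev : V → (polynomialFunctions V →+* ℂ) := fun x =>
    (Pi.evalRingHom (fun _ : V => ℂ) x).comp (polynomialFunctions V).val.toRingHom
  have hmap : ∀ x, P.map (ev x) =
      ∏ c, (Polynomial.X - Polynomial.C ((Q c : V → ℂ) x)) := by
    intro x
    simp only [P, Polynomial.map_prod, Polynomial.map_sub, Polynomial.map_X, Polynomial.map_C]
    rfl
  have hmapinv : ∀ (h : G) (x : V), P.map (ev (h • x)) = P.map (ev x) := by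
    intro h x
    rw [hmap, hmap]
    refine Fintype.prod_equiv (MulAction.toPerm h⁻¹) _ _ fun c => ?_
    rw [hQsmul]
    rfl
  have hcoef : ∀ (j : ℕ) (x : V), (P.coeff j : V → ℂ) x = (P.map (ev x)).coeff j := by
    intro j x
    rw [Polynomial.coeff_map]
    rfl
  have hreg : ∀ j : ℕ, ∃ φ : OrbitSpace G → ℂ, φ ∈ regularFunctions G ∧
      φ ∘ proj G = (P.coeff j : V → ℂ) := fun j =>
    (exists_regularFunction G _ (P.coeff j).2 fun g x => by
      rw [hcoef, hcoef, hmapinv]).exists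
  choose p hp hpproj using hreg
  have hsum : ∀ (x : V) (t : ℂ), ∑ j : Fin (P.natDegree + 1), (P.coeff j : V → ℂ) x * t ^ (j : ℕ) =
      ∏ c, (t - (Q c : V → ℂ) x) := by
    intro x t
    have h1 : (P.map (ev x)).eval t = ∏ c, (t - (Q c : V → ℂ) x) := by
      rw [hmap, Polynomial.eval_prod]
      simp
    rw [← h1, Polynomial.eval_map, Polynomial.eval₂_eq_sum_range, Finset.sum_range]
    rfl
  have hQ1 : ∀ x, (Q ((1 : G) : G ⧸ K) : V → ℂ) x = q x := fun x => by
    rw [hQmk, inv_one, one_smul]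
  have hroot : ∀ x, ∏ c, (q x - (Q c : V → ℂ) x) = 0 := fun x =>
    Finset.prod_eq_zero (Finset.mem_univ ((1 : G) : G ⧸ K)) (by rw [hQ1, sub_self])
  -- The cofactor of `t - q v`; its value at `q v` is the derivative of `P` there, non-zero because
  -- `q` separates the orbit.
  set R : ℂ → ℂ := fun t => ∏ c ∈ Finset.univ.erase ((1 : G) : G ⧸ K), (t - (Q c : V → ℂ) v) with hR
  have hRne : R (q v) ≠ 0 := by
    refine Finset.prod_ne_zero_iff.2 fun c hc => ?_
    have hc1 := Finset.ne_of_mem_erase hc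
    induction c using QuotientGroup.induction_on with
    | H a =>
      rw [hQmk, sub_ne_zero]
      refine (hsep _ fun ha => hc1 ?_).symm
      exact (QuotientGroup.eq.2 (by simpa using ha))
  have hRd : DifferentiableAt ℂ R (q v) := by
    have : Differentiable ℂ R := by
      simp only [hR]
      fun_prop
    exact this _
  have hder : HasDerivAt (fun t : ℂ => ∑ j : Fin (P.natDegree + 1),
      (P.coeff j : V → ℂ) v * t ^ (j : ℕ)) (R (q v)) (q v) := by
    have h1 : (fun t : ℂ => ∑ j : Fin (P.natDegree + 1), (P.coeff j : V → ℂ) v * t ^ (j : ℕ)) =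
        fun t => (t - q v) * R t := by
      ext t
      rw [hsum, ← Finset.mul_prod_erase _ _ (Finset.mem_univ ((1 : G) : G ⧸ K)), hQ1]
    rw [h1]
    have h2 : HasDerivAt (fun t => (t - q v) * R t) _ (q v) :=
      ((hasDerivAt_id (q v)).sub_const (q v)).mul hRd.hasDerivAt
    convert h2 using 1
    simp
  obtain ⟨h, hh, hhroot⟩ := exists_analyticAt_simple_root
    (fun j : Fin (P.natDegree + 1) => (P.coeff j : V → ℂ) v) (q v)
    (by rw [hsum, hroot]) hRne hder
  have hpv : ∀ j x, p j (proj G x) = (P.coeff j : V → ℂ) x := fun j x => congrFun (hpproj j) x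
  refine ⟨fun y => h fun j : Fin (P.natDegree + 1) => p j y,
    ⟨P.natDegree + 1, fun j => p j, h, fun j => hp j, ?_, Eventually.of_forall fun _ => rfl⟩, ?_⟩
  · simpa only [hpv] using hh
  · have hc₁ : ContinuousAt (fun x => fun j : Fin (P.natDegree + 1) => (P.coeff j : V → ℂ) x) v :=
      continuousAt_pi.2 fun j =>
        (analyticAt_of_mem_polynomialFunctions (P.coeff j).2 v).continuousAt
    have hc := hc₁.prodMk (analyticAt_of_mem_polynomialFunctions hq v).continuousAt
    filter_upwards [hc.eventually hhroot] with x hx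
    simp only [hpv]
    exact hx (by rw [hsum, hroot])

end Germs

end FiniteQuotient

namespace FiniteQuotient

/-! ### The relation on `V × W` attached to a biholomorphism of quotients. -/

section Correspondence

variable {V : Type*} [NormedAddCommGroup V] [NormedSpace ℂ V]
  {W : Type*} [NormedAddCommGroup W] [NormedSpace ℂ W]

/-- The properties of the relation `f (Gv) = Hw` attached to a biholomorphism `f : V/G → W/H` that
are needed to lift the inverse of `f`. -/
structure OrbitCorrespondence (G : Subgroup (V ≃ₗ[ℂ] V)) (H : Subgroup (W ≃ₗ[ℂ] W))
    (R : V → W → Prop) : Prop where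
  exists_left : ∀ w, ∃ v, R v w
  smul_left : ∀ {v w} (g : G), R v w → R (g • v) w
  smul_right : ∀ {v w} (h : H), R v w → R v (h • w)
  transitive_left : ∀ {v v' w}, R v w → R v' w → ∃ g : G, v' = g • v
  eventually_exists : ∀ {v w}, R v w → ∀ N ∈ 𝓝 v, ∀ᶠ w' in 𝓝 w, ∃ v' ∈ N, R v' w'
  germ : ∀ {v w}, R v w → ∀ q ∈ polynomialFunctions V,
    (∀ k ∈ MulAction.stabilizer G v, ∀ x, q (k • x) = q x) →
      ∃ q' : W → ℂ, AnalyticAt ℂ q' w ∧ ∀ᶠ p : V × W in 𝓝 (v, w), R p.1 p.2 → q' p.2 = q p.1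
  isClosed : IsClosed {p : V × W | R p.1 p.2}
  card_eq : ∀ {v w}, R v w → FixesHyperplane G v → FixesHyperplane H w →
    Nat.card (MulAction.stabilizer G v) = Nat.card (MulAction.stabilizer H w)

variable [FiniteDimensional ℂ V] [FiniteDimensional ℂ W]
  {G : Subgroup (V ≃ₗ[ℂ] V)} [Finite G] {H : Subgroup (W ≃ₗ[ℂ] W)} [Finite H]

/-- The assignment of strata `C ↦ D` is injective, since strata are determined by their closures; by
the equality of the finite cardinalities it is onto. -/
theorem exists_codimOneStratum_symm
    (hkl : (codimOneStrata G).ncard = (codimOneStrata H).ncard)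
    (f : OrbitSpace G ≃ OrbitSpace H)
    (hstrata : ∀ (C : Set (OrbitSpace G)) (r : ℕ), IsCodimOneStratum G C r →
      ∃ D : Set (OrbitSpace H), IsCodimOneStratum H D r ∧ f '' closure C = closure D)
    (D : Set (OrbitSpace H)) (s : ℕ) (hD : IsCodimOneStratum H D s) :
    ∃ C : Set (OrbitSpace G), IsCodimOneStratum G C s ∧ f.symm '' closure D = closure C := by
  have h1 : ∀ C ∈ codimOneStrata G, ∃ D : Set (OrbitSpace H), ∃ r, IsCodimOneStratum G C r ∧
      IsCodimOneStratum H D r ∧ f '' closure C = closure D := by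
    rintro C ⟨r, hC⟩
    obtain ⟨D, hD, h⟩ := hstrata C r hC
    exact ⟨D, r, hC, hD, h⟩
  choose Θ r hC hΘ hcl using h1
  obtain ⟨C, hCmem, rfl⟩ := surj_on_of_inj_on_of_ncard_le
    (s := codimOneStrata G) (t := codimOneStrata H) Θ
    (fun C h => ⟨r C h, hΘ C h⟩) (fun C₁ C₂ h₁ h₂ h => by
      have h3 : closure C₁ = closure C₂ := by
        apply f.injective.image_injective
        rw [hcl C₁ h₁, hcl C₂ h₂, h]
      refine Subset.antisymm ?_ ?_
      · exact (hC C₁ h₁).subset_of_closure_subset (hC C₂ h₂) (h3 ▸ subset_closure)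
      · exact (hC C₂ h₂).subset_of_closure_subset (hC C₁ h₁) (h3 ▸ subset_closure))
    hkl.ge finite_codimOneStrata D ⟨s, hD⟩
  refine ⟨C, ?_, ?_⟩
  · rw [hD.order_unique (hΘ C hCmem)]
    exact hC C hCmem
  · rw [← hcl C hCmem, Equiv.symm_image_image]

theorem card_stabilizer_eq_of_strata (f : OrbitSpace G ≃ OrbitSpace H)
    (hstrata : ∀ (C : Set (OrbitSpace G)) (r : ℕ), IsCodimOneStratum G C r →
      ∃ D : Set (OrbitSpace H), IsCodimOneStratum H D r ∧ f '' closure C = closure D)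
    {v : V} {w : W} (h : f (proj G v) = proj H w) (hv : FixesHyperplane G v)
    (hw : FixesHyperplane H w) (hne : MulAction.stabilizer G v ≠ ⊥) :
    Nat.card (MulAction.stabilizer G v) = Nat.card (MulAction.stabilizer H w) := by
  obtain ⟨C, hC, hvC⟩ := hv.exists_isCodimOneStratum hne
  obtain ⟨D, hD, hCD⟩ := hstrata C _ hC
  refine ((hw.mem_stratum_of_mem_closure hD ?_).2).symm
  rw [← hCD, ← h]
  exact mem_image_of_mem f (subset_closure hvC)

theorem orbitCorrespondence_of_isBiholomorphism (f : OrbitSpace G ≃ OrbitSpace H)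
    (hf : IsBiholomorphism G H f)
    (hstrata : ∀ (C : Set (OrbitSpace G)) (r : ℕ), IsCodimOneStratum G C r →
      ∃ D : Set (OrbitSpace H), IsCodimOneStratum H D r ∧ f '' closure C = closure D)
    (hstrata' : ∀ (D : Set (OrbitSpace H)) (r : ℕ), IsCodimOneStratum H D r →
      ∃ C : Set (OrbitSpace G), IsCodimOneStratum G C r ∧ f.symm '' closure D = closure C) :
    OrbitCorrespondence G H (fun v w => f (proj G v) = proj H w) where
  exists_left w := by
    obtain ⟨v, hv⟩ := Quotient.exists_rep (f.symm (proj H w))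
    refine ⟨v, ?_⟩
    rw [← f.eq_symm_apply]
    exact hv
  smul_left g h := by rw [proj_smul, h]
  smul_right k h := by rw [proj_smul, h]
  transitive_left h h' := (proj_eq_proj_iff G).1 (f.injective (h'.trans h.symm))
  eventually_exists {v w} h N hN := by
    have h1 : proj G '' N ∈ 𝓝 (f.symm (proj H w)) := by
      rw [← h, f.symm_apply_apply]
      exact (isOpenMap_proj (G := G)).image_mem_nhds hN
    have h2 : ContinuousAt (fun w => f.symm (proj H w)) w :=
      (hf.2.1.comp continuous_proj).continuousAt
    filter_upwards [h2.eventually h1] with w' hw'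
    obtain ⟨v', hv', h3⟩ := hw'
    exact ⟨v', hv', by rw [h3, f.apply_symm_apply]⟩
  germ {v w} h q hq hinv := by
    have key : ∀ q ∈ polynomialFunctions V,
        (∀ k ∈ MulAction.stabilizer G v, ∀ x, q (k • x) = q x) →
        (∀ g ∉ MulAction.stabilizer G v, q (g • v) ≠ q v) →
        ∃ q' : W → ℂ, AnalyticAt ℂ q' w ∧
          ∀ᶠ p : V × W in 𝓝 (v, w), f (proj G p.1) = proj H p.2 → q' p.2 = q p.1 := by
      intro q hq hinv hsep
      obtain ⟨ψ, hψ, hψq⟩ := exists_isHolomorphicAt_of_separating v hq hinv hsep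
      have h1 : IsHolomorphicAt H (ψ ∘ f.symm) (proj H w) :=
        hf.2.2 _ ψ (by rw [← h, f.symm_apply_apply]; exact hψ)
      refine ⟨_, h1.analyticAt_comp_proj, ?_⟩
      filter_upwards [(continuous_fst.tendsto (v, w)).eventually hψq] with p hp hR
      rw [← hp]
      simp only [Function.comp_apply, ← hR, f.symm_apply_apply]
    obtain ⟨s, hs, hsinv, hsv, hszero⟩ := exists_separating_invariant (G := G) v
    -- Since `s` vanishes at the other points of the orbit, these are the only `c` for which `q + c
    -- * s` fails to separate them from `v`. Then `q = (q + c * s) - c * s` is a combination of two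
    -- separating invariants.
    obtain ⟨c, hc⟩ : ∃ c : ℂ, c ∉ range fun g : G => (q (g • v) - q v) / s v :=
      ((finite_range _).infinite_compl).nonempty
    have hsum : ∀ c : ℂ, (fun x => q x + c * s x) ∈ polynomialFunctions V := fun c =>
      add_mem hq (mul_mem (const_mem_polynomialFunctions c) hs)
    obtain ⟨a, ha, ha'⟩ := key _ (hsum c) (fun k hk x => by rw [hinv k hk, hsinv k hk])
      (fun g hg heq => hc ⟨g, by
        rw [hszero g hg] at heq
        field_simp
        linear_combination heq⟩)
    obtain ⟨b, hb, hb'⟩ := key s hs hsinv (fun g hg => by rw [hszero g hg]; exact hsv.symm)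
    refine ⟨fun x => a x - c * b x, ha.sub (analyticAt_const.mul hb), ?_⟩
    filter_upwards [ha', hb'] with p hp1 hp2 hR
    rw [hp1 hR, hp2 hR]
    ring
  isClosed := by
    have : T2Space (OrbitSpace H) := by
      have : LocallyCompactSpace W :=
        have : ProperSpace W := FiniteDimensional.proper ℂ W
        inferInstance
      exact t2Space_of_properlyDiscontinuousSMul_of_t2Space (Γ := H) (T := W)
    exact isClosed_eq (hf.1.1.comp (continuous_proj.comp continuous_fst))
      (continuous_proj.comp continuous_snd)
  -- A non-trivial isotropy group on either side puts the point in a stratum, whose order is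
  -- preserved; hence the need for the matching of strata in both directions.
  card_eq {v w} h hv hw := by
    by_cases h1 : MulAction.stabilizer G v = ⊥
    · by_cases h2 : MulAction.stabilizer H w = ⊥
      · rw [h1, h2]
        simp
      · exact (card_stabilizer_eq_of_strata f.symm hstrata'
          (by rw [← h, f.symm_apply_apply]) hw hv h2).symm
    · exact card_stabilizer_eq_of_strata f hstrata h hv hw h1

end Correspondence

end FiniteQuotient

namespace FiniteQuotient

/-! ### Normal form of a pseudoreflection generating an isotropy group. -/

section Reflection

variable {V : Type*} [NormedAddCommGroup V] [NormedSpace ℂ V] {G : Subgroup (V ≃ₗ[ℂ] V)}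

/-- The isotropy group of `v` is generated by the pseudoreflection
`x ↦ x + (ξ - 1) l(x) e`, with `l(e) = 1`. -/
structure IsReflectionAt (G : Subgroup (V ≃ₗ[ℂ] V)) (v : V) (g : G) (l : V →ₗ[ℂ] ℂ) (e : V)
    (ξ : ℂ) : Prop where
  stabilizer_eq : MulAction.stabilizer G v = Subgroup.zpowers g
  apply_eq_one : l e = 1
  ker_eq : LinearMap.ker l = isotropySubspace G v
  isPrimitiveRoot : IsPrimitiveRoot ξ (orderOf g)
  one_lt : 1 < orderOf g
  smul_eq : ∀ x, g • x = x + ((ξ - 1) * l x) • e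

namespace IsReflectionAt

variable {v : V} {g : G} {l : V →ₗ[ℂ] ℂ} {e : V} {ξ : ℂ}

theorem apply_self (h : IsReflectionAt G v g l e ξ) : l v = 0 := by
  rw [← LinearMap.mem_ker, h.ker_eq]
  exact mem_isotropySubspace_self G v

theorem exists_pow_eq [Finite G] (h : IsReflectionAt G v g l e ξ) {k : G}
    (hk : k ∈ MulAction.stabilizer G v) : ∃ n : ℕ, g ^ n = k := by
  rw [h.stabilizer_eq] at hk
  exact (Submonoid.mem_powers_iff _ _).1 (mem_powers_iff_mem_zpowers.2 hk)

theorem pow_smul_eq (h : IsReflectionAt G v g l e ξ) (n : ℕ) (x : V) :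
    g ^ n • x = x + ((ξ ^ n - 1) * l x) • e :=
  pow_smul_eq_of_reflection h.apply_eq_one h.smul_eq n x

theorem apply_pow_smul (h : IsReflectionAt G v g l e ξ) (n : ℕ) (x : V) :
    l (g ^ n • x) = ξ ^ n * l x := by
  rw [h.pow_smul_eq, map_add, map_smul, h.apply_eq_one, smul_eq_mul]
  ring

theorem card_eq (h : IsReflectionAt G v g l e ξ) :
    Nat.card (MulAction.stabilizer G v) = orderOf g := by
  rw [h.stabilizer_eq, Nat.card_zpowers]

/-- Expresses the mirror through the order of the isotropy group, the quantity that a correspondence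
of orbits preserves. -/
theorem apply_eq_zero_iff [Finite G] (h : IsReflectionAt G v g l e ξ) {x : V}
    (hx : MulAction.stabilizer G x ≤ MulAction.stabilizer G v) :
    l x = 0 ↔ Nat.card (MulAction.stabilizer G x) ≠ 1 := by
  rw [Ne, Subgroup.card_eq_one]
  constructor
  · intro hlx hbot
    have hgx : g ∈ MulAction.stabilizer G x := by
      rw [MulAction.mem_stabilizer_iff, h.smul_eq, hlx, mul_zero, zero_smul, add_zero]
    rw [hbot, Subgroup.mem_bot] at hgx
    have := h.one_lt
    rw [hgx, orderOf_one] at this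
    exact lt_irrefl _ this
  · intro hne
    obtain ⟨k, hk, hk1⟩ := (Subgroup.bot_or_exists_ne_one _).resolve_left hne
    obtain ⟨n, hn⟩ := h.exists_pow_eq (hx hk)
    rw [← hn] at hk hk1
    exact apply_eq_zero_of_pow_smul_eq h.apply_eq_one h.smul_eq h.isPrimitiveRoot hk1 hk

end IsReflectionAt

theorem FixesHyperplane.exists_isReflectionAt [FiniteDimensional ℂ V] [Finite G] {v : V} (hv : FixesHyperplane G v)
    (hne : MulAction.stabilizer G v ≠ ⊥) :
    ∃ (g : G) (l : V →ₗ[ℂ] ℂ) (e : V) (ξ : ℂ), IsReflectionAt G v g l e ξ := by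
  obtain ⟨g, l, e, ξ, h1, h2, h3, h4, h5, h6⟩ := hv.exists_generator hne
  exact ⟨g, l, e, ξ, h1, h2, h3, h4, h5, h6⟩

end Reflection

/-! ### Local lifts at related points whose isotropy groups fix hyperplanes. -/

section LocalLift

variable {V : Type*} [NormedAddCommGroup V] [NormedSpace ℂ V] [FiniteDimensional ℂ V]
  {W : Type*} [NormedAddCommGroup W] [NormedSpace ℂ W] [FiniteDimensional ℂ W]
  {G : Subgroup (V ≃ₗ[ℂ] V)} [Finite G] {H : Subgroup (W ≃ₗ[ℂ] W)} [Finite H]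

namespace OrbitCorrespondence

variable {R : V → W → Prop} {v : V} {w : W}

omit [FiniteDimensional ℂ V] [FiniteDimensional ℂ W] [Finite G] [Finite H] in
theorem eventually_exists_prod (hR : OrbitCorrespondence G H R) (hvw : R v w) {A : V × W → Prop}
    (hA : ∀ᶠ p in 𝓝 (v, w), A p) : ∀ᶠ x in 𝓝 w, ∃ y, R y x ∧ A (y, x) := by
  rw [nhds_prod_eq] at hA
  obtain ⟨p, hp, q, hq, hpq⟩ := eventually_prod_iff.1 hA
  filter_upwards [hR.eventually_exists hvw _ hp, hq] with x ⟨y, hy, hyx⟩ hx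
  exact ⟨y, hyx, hpq hy hx⟩

omit [FiniteDimensional ℂ W] [Finite G] [Finite H] in
theorem exists_linear_germ [CompleteSpace W] (hR : OrbitCorrespondence G H R) (hvw : R v w)
    (P : V →ₗ[ℂ] V) (hP : ∀ k ∈ MulAction.stabilizer G v, ∀ x, P (k • x) = P x) :
    ∃ P' : W → V, AnalyticAt ℂ P' w ∧
      ∀ᶠ p : V × W in 𝓝 (v, w), R p.1 p.2 → P' p.2 = P p.1 := by
  let b := Module.finBasis ℂ V
  have h := fun i => hR.germ hvw (fun x => b.coord i (P x))
    (linear_mem_polynomialFunctions (b.coord i ∘ₗ P)) (fun k hk x => by rw [hP k hk])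
  choose q hq hqR using h
  refine ⟨fun x => ∑ i, q i x • b i, Finset.analyticAt_fun_sum _ fun i _ =>
    (hq i).smul analyticAt_const, ?_⟩
  filter_upwards [eventually_all.2 hqR] with p hp hpR
  have : ∀ i, q i p.2 = b.repr (P p.1) i := fun i => by rw [hp i hpR]; rfl
  simp only [this]
  exact b.sum_repr (P p.1)

/-- The isotropy-invariant `l ^ r` transports to a germ `N` at `w`. It is invariant under `h`, and
it vanishes on the mirror of `h` because mirrors correspond by `card_eq`; so it vanishes there to
order `r`. Swapping the roles of `G` and `H` gives the reverse estimate. -/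
theorem exists_reflection_germ (hR : OrbitCorrespondence G H R)
    (hvw : R v w) (hv : FixesHyperplane G v) (hw : FixesHyperplane H w) {g : G} {l : V →ₗ[ℂ] ℂ} {e : V} {ξ : ℂ}
    (hg : IsReflectionAt G v g l e ξ) {h : H} {m : W →ₗ[ℂ] ℂ} {d : W} {ζ : ℂ}
    (hh : IsReflectionAt H w h m d ζ) {r : ℕ} (hr : orderOf g = r) (hr' : orderOf h = r) :
    ∃ N : W → ℂ, AnalyticAt ℂ N w ∧
      (∀ᶠ p : V × W in 𝓝 (v, w), R p.1 p.2 → N p.2 = l p.1 ^ r) ∧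
      ∃ C : ℝ, ∀ᶠ x in 𝓝 w, ‖N x‖ ≤ C * ‖m x‖ ^ r := by
  obtain ⟨N, hN, hNR⟩ := hR.germ hvw (fun x => l x ^ r)
    (pow_mem (linear_mem_polynomialFunctions l) r) (fun k hk x => by
      obtain ⟨n, rfl⟩ := hg.exists_pow_eq hk
      rw [hg.apply_pow_smul, mul_pow, ← pow_mul, mul_comm n, pow_mul, ← hr,
        hg.isPrimitiveRoot.pow_eq_one, one_pow, one_mul])
  refine ⟨N, hN, hNR, ?_⟩
  have hr0 : 0 < r := hr ▸ (zero_lt_one.trans hg.one_lt)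
  have hhw : h • w = w := by
    have : h ∈ MulAction.stabilizer H w := by
      rw [hh.stabilizer_eq]
      exact Subgroup.mem_zpowers h
    exact this
  have hm := LinearMap.coe_toContinuousLinearMap' m
  have key := exists_norm_le_mul_pow_of_invariant (l := LinearMap.toContinuousLinearMap m)
    (e := d) (v := w) (r := r) (ξ := ζ) (T := N) (by rw [hm]; exact hh.apply_eq_one)
    (by rw [hm]; exact hh.apply_self) hr0 (hr' ▸ hh.isPrimitiveRoot)
    (hN.eventually_analyticAt.mono fun x hx => hx.differentiableAt) ?_ ?_
  · simpa only [hm] using key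
  · have hc : Tendsto (fun p : V × W => (p.1, h • p.2)) (𝓝 (v, w)) (𝓝 (v, w)) := by
      have : Continuous fun p : V × W => (p.1, h • p.2) :=
        continuous_fst.prodMk ((continuous_const_smul h).comp continuous_snd)
      simpa [hhw] using this.tendsto (v, w)
    filter_upwards [hR.eventually_exists_prod hvw (hNR.and (hc.eventually hNR))] with x hx
    obtain ⟨y, hyx, h1, h2⟩ := hx
    rw [hm, ← hh.smul_eq, h1 hyx]
    exact h2 (hR.smul_right h hyx)
  · have h1 : ∀ᶠ p : V × W in 𝓝 (v, w),
        MulAction.stabilizer G p.1 ≤ MulAction.stabilizer G v ∧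
        MulAction.stabilizer H p.2 ≤ MulAction.stabilizer H w :=
      ((continuous_fst.tendsto (v, w)).eventually (eventually_stabilizer_le v)).and
        ((continuous_snd.tendsto (v, w)).eventually (eventually_stabilizer_le w))
    filter_upwards [hR.eventually_exists_prod hvw (hNR.and h1)] with x hx hmx
    obtain ⟨y, hyx, h2, h3, h4⟩ := hx
    rw [hm] at hmx
    have h5 := (hh.apply_eq_zero_iff h4).1 hmx
    rw [← hR.card_eq hyx (hv.of_stabilizer_le h3) (hw.of_stabilizer_le h4)] at h5
    rw [h2 hyx, (hg.apply_eq_zero_iff h3).2 h5, zero_pow hr0.ne']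

end OrbitCorrespondence

/-- A holomorphic function `N` comparable to the `r`-th power of a linear form has a holomorphic
`r`-th root. -/
theorem exists_root_of_comparable {m : W →L[ℂ] ℂ} (hm : m ≠ 0) {w : W}
    {r : ℕ} (hr : 0 < r) {N : W → ℂ} (hN : ∀ᶠ x in 𝓝 w, DifferentiableAt ℂ N x) {C₁ C₂ : ℝ}
    (h₁ : ∀ᶠ x in 𝓝 w, ‖N x‖ ≤ C₁ * ‖m x‖ ^ r) (h₂ : ∀ᶠ x in 𝓝 w, ‖m x‖ ^ r ≤ C₂ * ‖N x‖) :
    ∃ F : W → ℂ, ∀ᶠ x in 𝓝 w, DifferentiableAt ℂ F x ∧ F x ^ r = N x := by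
  obtain ⟨δ, hδ, hball⟩ := Metric.eventually_nhds_iff_ball.1 (hN.and (h₁.and h₂))
  have hopen : IsOpen {x | m x ≠ 0} := isOpen_ne_fun m.continuous continuous_const
  -- `U` extends the quotient `N / m ^ r`, which `h₁` bounds.
  obtain ⟨U, hU, hUN⟩ := exists_differentiableOn_extension_of_ker
    (isOpen_ball (x := w) (ε := δ)) m hm (f := fun x => N x * (m x ^ r)⁻¹)
    (fun x hx => (((hball x hx.1).1.mul
      ((m.differentiableAt.pow r).inv (pow_ne_zero r hx.2)))).differentiableWithinAt)
    (fun x hx => ⟨C₁, by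
      filter_upwards [isOpen_ball.mem_nhds hx] with y hy hmy
      have h3 := (hball y hy).2.1
      have h4 : 0 < ‖m y‖ ^ r := pow_pos (norm_pos_iff.2 hmy) r
      rw [norm_mul, norm_inv, norm_pow]
      rwa [← div_eq_mul_inv, div_le_iff₀ h4]⟩)
  have hw : w ∈ ball w δ := mem_ball_self hδ
  have hUd : ∀ x ∈ ball w δ, DifferentiableAt ℂ U x := fun x hx =>
    hU.differentiableAt (isOpen_ball.mem_nhds hx)
  have hfac : ∀ x ∈ ball w δ, N x = m x ^ r * U x := by
    intro x hx
    by_cases hmx : m x = 0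
    · have h3 := (hball x hx).2.1
      rw [hmx, norm_zero, zero_pow hr.ne', mul_zero] at h3
      rw [hmx, zero_pow hr.ne', zero_mul]
      exact norm_le_zero_iff.1 h3
    · rw [hUN x hmx]
      field_simp
  -- Off the mirror `h₂` reads `1 ≤ C₂ * ‖U x‖`, so `U` cannot tend to `0`.
  have hUw : U w ≠ 0 := by
    intro h0
    set c : ℝ := (|C₂| + 1)⁻¹ with hc
    have hc0 : 0 < c := by positivity
    have hsmall : ∀ᶠ x in 𝓝 w, ‖U x‖ < c :=
      (hUd w hw).continuousAt.norm.eventually (Iio_mem_nhds (by simpa [h0] using hc0))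
    have hdense : w ∈ closure {x : W | m x ≠ 0} := by
      have := dense_forall_apply_ne_zero {m} (by simpa using hm) w
      simpa using this
    obtain ⟨x, hmx, hxU, hxb⟩ := ((mem_closure_iff_frequently.1 hdense).and_eventually
      (hsmall.and (isOpen_ball.mem_nhds hw))).exists
    have h3 := (hball x hxb).2.2
    rw [hfac x hxb, norm_mul, norm_pow] at h3
    have h4 : 0 < ‖m x‖ ^ r := pow_pos (norm_pos_iff.2 hmx) r
    have h5 : C₂ * ‖U x‖ < 1 := by
      calc C₂ * ‖U x‖ ≤ (|C₂| + 1) * ‖U x‖ := by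
            gcongr
            linarith [le_abs_self C₂]
        _ < (|C₂| + 1) * c := by gcongr
        _ = 1 := by rw [hc]; field_simp
    nlinarith
  obtain ⟨κ, hκ⟩ := IsAlgClosed.exists_pow_nat_eq (U w) hr
  -- Dividing by `U w` brings the argument of the logarithm near `1`, inside the slit plane; `κ`
  -- restores the root of `U w`.
  refine ⟨fun x => m x * (κ * Complex.exp (Complex.log (U x / U w) / r)), ?_⟩
  have hslit : ∀ᶠ x in 𝓝 w, U x / U w ∈ Complex.slitPlane := by
    refine ((hUd w hw).continuousAt.div_const (U w)).eventually
      (Complex.isOpen_slitPlane.mem_nhds ?_)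
    simp only [div_self hUw]
    exact Complex.one_mem_slitPlane
  filter_upwards [hslit, isOpen_ball.mem_nhds hw] with x hx hxb
  refine ⟨?_, ?_⟩
  · have h1 : DifferentiableAt ℂ (fun x => U x / U w) x := by
      simp only [div_eq_mul_inv]
      exact (hUd x hxb).mul_const _
    have h2 : DifferentiableAt ℂ (fun x => Complex.log (U x / U w) / r) x := by
      simp only [div_eq_mul_inv (b := (r : ℂ))]
      exact (h1.clog hx).mul_const _
    exact m.differentiableAt.mul (h2.cexp.const_mul κ)
  · have hr' : (r : ℂ) ≠ 0 := Nat.cast_ne_zero.2 hr.ne'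
    rw [mul_pow, mul_pow, hκ, ← Complex.exp_nat_mul, mul_div_cancel₀ _ hr',
      Complex.exp_log (Complex.slitPlane_ne_zero hx), mul_div_cancel₀ _ hUw, hfac x hxb]

/-- At points whose isotropy groups fix hyperplanes, a correspondence of orbits lifts locally. -/
theorem OrbitCorrespondence.exists_local_lift {R : V → W → Prop} {v : V} {w : W}
    (hR : OrbitCorrespondence G H R) (hR' : OrbitCorrespondence H G fun w v => R v w)
    (hvw : R v w) (hv : FixesHyperplane G v) (hw : FixesHyperplane H w) :
    ∃ Φ : W → V, Φ w = v ∧ ∀ᶠ x in 𝓝 w, DifferentiableAt ℂ Φ x ∧ R (Φ x) x := by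
  have : CompleteSpace W := FiniteDimensional.complete ℂ W
  -- The normalisation `Φ w = v` is obtained by composing with an element of `G`.
  suffices hsuff : ∃ Φ : W → V, ∀ᶠ x in 𝓝 w, DifferentiableAt ℂ Φ x ∧ R (Φ x) x by
    obtain ⟨Φ, hΦ⟩ := hsuff
    obtain ⟨g, hg⟩ := hR.transitive_left hΦ.self_of_nhds.2 hvw
    refine ⟨fun x => g • Φ x, hg.symm, hΦ.mono fun x hx => ⟨?_, hR.smul_left g hx.2⟩⟩
    exact (LinearMap.toContinuousLinearMap
      ((g : V ≃ₗ[ℂ] V) : V →ₗ[ℂ] V)).differentiableAt.comp x hx.1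
  by_cases hbot : MulAction.stabilizer G v = ⊥
  · obtain ⟨P, hP, hPR⟩ := hR.exists_linear_germ hvw LinearMap.id (fun k hk x => by
      rw [hbot, Subgroup.mem_bot] at hk
      rw [hk, one_smul])
    refine ⟨P, ?_⟩
    filter_upwards [hP.eventually_analyticAt, hR.eventually_exists_prod hvw hPR] with x hx hy
    obtain ⟨y, hyx, h1⟩ := hy
    refine ⟨hx.differentiableAt, ?_⟩
    rw [h1 hyx]
    exact hyx
  have hcard := hR.card_eq hvw hv hw
  have hbot' : MulAction.stabilizer H w ≠ ⊥ := by
    intro h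
    rw [h, Subgroup.card_bot, Subgroup.card_eq_one] at hcard
    exact hbot hcard
  obtain ⟨g, l, e, ξ, hg⟩ := hv.exists_isReflectionAt hbot
  obtain ⟨h, m, d, ζ, hh⟩ := hw.exists_isReflectionAt hbot'
  have hord : orderOf h = orderOf g := by rw [← hg.card_eq, ← hh.card_eq, hcard]
  have hr0 : 0 < orderOf g := zero_lt_one.trans hg.one_lt
  obtain ⟨N, hN, hNR, C₁, hC₁⟩ := hR.exists_reflection_germ hvw hv hw hg hh rfl hord
  obtain ⟨T, hT, hTR, C₂, hC₂⟩ := hR'.exists_reflection_germ hvw hw hv hh hg hord rfl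
  have hTR' : ∀ᶠ p : V × W in 𝓝 (v, w), R p.1 p.2 → T p.1 = m p.2 ^ orderOf g :=
    (continuous_swap.tendsto (v, w)).eventually hTR
  -- For related `y` and `x` one has `m x ^ r = T y`, `‖T y‖ ≤ C₂ * ‖l y‖ ^ r` and `l y ^ r = N x`.
  have hlow : ∀ᶠ x in 𝓝 w, ‖m x‖ ^ orderOf g ≤ C₂ * ‖N x‖ := by
    filter_upwards [hR.eventually_exists_prod hvw (hNR.and (hTR'.and
      ((continuous_fst.tendsto (v, w)).eventually hC₂)))] with x hx
    obtain ⟨y, hyx, h1, h2, h3⟩ := hx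
    rw [h2 hyx, norm_pow] at h3
    rw [h1 hyx, norm_pow]
    exact h3
  have hm := LinearMap.coe_toContinuousLinearMap' m
  obtain ⟨F, hF⟩ := exists_root_of_comparable (m := LinearMap.toContinuousLinearMap m)
    (fun h0 => by
      have h1 := hh.apply_eq_one
      rw [← hm, h0] at h1
      exact zero_ne_one h1) hr0 (hN.eventually_analyticAt.mono fun x hx => hx.differentiableAt)
    (by simpa only [hm] using hC₁) (by simpa only [hm] using hlow)
  -- The projection onto the mirror along `e` is isotropy-invariant; with the `e`-coordinate `F` it
  -- determines the lift.
  obtain ⟨P, hP, hPR⟩ := hR.exists_linear_germ hvw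
    (LinearMap.id - (LinearMap.toSpanSingleton ℂ V e) ∘ₗ l) (fun k hk x => by
      obtain ⟨n, rfl⟩ := hg.exists_pow_eq hk
      simp only [LinearMap.sub_apply, LinearMap.id_apply, LinearMap.comp_apply,
        LinearMap.toSpanSingleton_apply, hg.apply_pow_smul]
      rw [hg.pow_smul_eq]
      module)
  refine ⟨fun x => P x + F x • e, ?_⟩
  filter_upwards [hP.eventually_analyticAt, hF,
    hR.eventually_exists_prod hvw (hNR.and hPR)] with x hPx hFx hy
  refine ⟨hPx.differentiableAt.add (hFx.1.smul_const e), ?_⟩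
  obtain ⟨y, hyx, h1, h2⟩ := hy
  have h3 : F x ^ orderOf g = l y ^ orderOf g := by rw [hFx.2, h1 hyx]
  have : NeZero (orderOf g) := ⟨hr0.ne'⟩
  -- `F x` and `l y` are `r`-th roots of the same number, so the candidate lift at `x` is `g ^ n •
  -- y`, whichever root was chosen.
  obtain ⟨n, hn⟩ : ∃ n : ℕ, F x = ξ ^ n * l y := by
    by_cases hly : l y = 0
    · rw [hly, zero_pow hr0.ne'] at h3
      exact ⟨0, by rw [hly, mul_zero]; exact eq_zero_of_pow_eq_zero h3⟩
    · have h4 : (F x / l y) ^ orderOf g = 1 := by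
        rw [div_pow, h3, div_self (pow_ne_zero _ hly)]
      obtain ⟨n, -, hn⟩ := hg.isPrimitiveRoot.eq_pow_of_pow_eq_one h4
      exact ⟨n, by rw [hn, div_mul_cancel₀ _ hly]⟩
  have h5 : P x + F x • e = g ^ n • y := by
    rw [h2 hyx, hg.pow_smul_eq, hn]
    simp only [LinearMap.sub_apply, LinearMap.id_apply, LinearMap.comp_apply,
      LinearMap.toSpanSingleton_apply]
    module
  rw [h5]
  exact hR.smul_left _ hyx

end LocalLift

end FiniteQuotient

namespace FiniteQuotient

/-! ### Uniqueness, gluing and continuation of lifts. -/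

section Continuation

variable {V : Type*} [NormedAddCommGroup V] [NormedSpace ℂ V] [FiniteDimensional ℂ V]
  {W : Type*} [NormedAddCommGroup W] [NormedSpace ℂ W]
  {G : Subgroup (V ≃ₗ[ℂ] V)} [Finite G]

omit [Finite G] in
theorem differentiableAt_const_smul_comp {g : G} {Φ : W → V} {x : W}
    (h : DifferentiableAt ℂ Φ x) : DifferentiableAt ℂ (fun y => g • Φ y) x :=
  (LinearMap.toContinuousLinearMap
    ((g : V ≃ₗ[ℂ] V) : V →ₗ[ℂ] V)).differentiableAt.comp x h

/-- Finitely many relatively closed sets `F₁ = g • F₂` cover `U`, so one of them contains an open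
set, and the identity theorem spreads that equality over `U`. -/
theorem exists_eqOn_smul {U : Set W} (hU : IsOpen U) (hconv : Convex ℝ U) (hne : U.Nonempty)
    {F₁ F₂ : W → V} (h₁ : ∀ x ∈ U, DifferentiableAt ℂ F₁ x) (h₂ : ∀ x ∈ U, DifferentiableAt ℂ F₂ x)
    (h : ∀ x ∈ U, ∃ g : G, F₁ x = g • F₂ x) : ∃ g : G, ∀ x ∈ U, F₁ x = g • F₂ x := by
  have : CompleteSpace V := FiniteDimensional.complete ℂ V
  have hd : ∀ g : G, ∀ x ∈ U, DifferentiableAt ℂ (fun y => g • F₂ y) x := fun g x hx =>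
    differentiableAt_const_smul_comp (h₂ x hx)
  obtain ⟨g, O, hO, ⟨x₀, hx₀⟩, hOU, hOg⟩ := exists_open_subset_of_subset_iUnion hU hne
    (fun g : G => {x | F₁ x = g • F₂ x}) (fun g => by
      have hc : ContinuousOn (fun x => F₁ x - g • F₂ x) U := fun x hx =>
        ((h₁ x hx).sub (hd g x hx)).continuousAt.continuousWithinAt
      have := hc.isOpen_inter_preimage hU (isOpen_compl_singleton (x := (0 : V)))
      convert this using 1
      ext x
      simp [sub_eq_zero])
    (fun x hx => by simpa using h x hx)
  refine ⟨g, eqOn_of_convex_of_eventuallyEq hU hconv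
    (fun x hx => (h₁ x hx).differentiableWithinAt)
    (fun x hx => (hd g x hx).differentiableWithinAt) (hOU hx₀) ?_⟩
  filter_upwards [hO.mem_nhds hx₀] with x hx using hOg hx

/-- `Φ` is a holomorphic selection of the relation `R` on `U`. -/
def IsLiftOn (R : V → W → Prop) (Φ : W → V) (U : Set W) : Prop :=
  ∀ x ∈ U, DifferentiableAt ℂ Φ x ∧ R (Φ x) x

variable {H : Subgroup (W ≃ₗ[ℂ] W)} {R : V → W → Prop}

omit [FiniteDimensional ℂ V] [Finite G] in
theorem IsLiftOn.mono {Φ : W → V} {U U' : Set W} (h : IsLiftOn R Φ U) (hU : U' ⊆ U) :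
    IsLiftOn R Φ U' := fun x hx => h x (hU hx)

omit [Finite G] in
theorem IsLiftOn.smul (hR : OrbitCorrespondence G H R) {Φ : W → V} {U : Set W}
    (h : IsLiftOn R Φ U) (g : G) : IsLiftOn R (fun x => g • Φ x) U := fun x hx =>
  ⟨differentiableAt_const_smul_comp (h x hx).1, hR.smul_left g (h x hx).2⟩

theorem IsLiftOn.exists_eqOn_smul (hR : OrbitCorrespondence G H R) {U : Set W} (hU : IsOpen U)
    (hconv : Convex ℝ U) (hne : U.Nonempty) {F₁ F₂ : W → V} (h₁ : IsLiftOn R F₁ U)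
    (h₂ : IsLiftOn R F₂ U) : ∃ g : G, ∀ x ∈ U, F₁ x = g • F₂ x :=
  FiniteQuotient.exists_eqOn_smul hU hconv hne (fun x hx => (h₁ x hx).1) (fun x hx => (h₂ x hx).1)
    fun x hx => hR.transitive_left (h₂ x hx).2 (h₁ x hx).2

/-- The overlap is convex, so one group element corrects `F₂` to agree with `F₁` on all of it. -/
theorem IsLiftOn.glue (hR : OrbitCorrespondence G H R) {U₁ U₂ : Set W} (hU₁ : IsOpen U₁)
    (hU₂ : IsOpen U₂) (hc₁ : Convex ℝ U₁) (hc₂ : Convex ℝ U₂) (hne : (U₁ ∩ U₂).Nonempty)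
    {F₁ F₂ : W → V} (h₁ : IsLiftOn R F₁ U₁) (h₂ : IsLiftOn R F₂ U₂) :
    ∃ F : W → V, IsLiftOn R F (U₁ ∪ U₂) ∧ EqOn F F₁ U₁ := by
  classical
  obtain ⟨g, hg⟩ := IsLiftOn.exists_eqOn_smul hR (hU₁.inter hU₂) (hc₁.inter hc₂) hne
    (h₁.mono inter_subset_left) (h₂.mono inter_subset_right)
  set F : W → V := fun x => if x ∈ U₁ then F₁ x else g • F₂ x with hF
  have hF₁ : EqOn F F₁ U₁ := fun x hx => by simp [hF, hx]
  have hF₂ : EqOn F (fun x => g • F₂ x) U₂ := by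
    intro x hx
    by_cases hx₁ : x ∈ U₁
    · rw [hF₁ hx₁]
      exact hg x ⟨hx₁, hx⟩
    · simp [hF, hx₁]
  refine ⟨F, ?_, hF₁⟩
  rintro x (hx | hx)
  · refine ⟨(h₁ x hx).1.congr_of_eventuallyEq (hF₁.eventuallyEq_of_mem (hU₁.mem_nhds hx)), ?_⟩
    rw [hF₁ hx]
    exact (h₁ x hx).2
  · have h := h₂.smul hR g x hx
    refine ⟨h.1.congr_of_eventuallyEq (hF₂.eventuallyEq_of_mem (hU₂.mem_nhds hx)), ?_⟩
    rw [hF₂ hx]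
    exact h.2

/-- Continuation of lifts along a segment. -/
theorem exists_lift_along_segment (hR : OrbitCorrespondence G H R) {a v : W}
    (hloc : ∀ x ∈ segment ℝ a v, ∃ Φ : W → V, ∃ U ∈ 𝓝 x, IsLiftOn R Φ U)
    {Φ₀ : W → V} {U₀ : Set W} (hU₀ : U₀ ∈ 𝓝 a) (hΦ₀ : IsLiftOn R Φ₀ U₀) :
    ∃ ε > 0, ∃ Φ : W → V, IsLiftOn R Φ (thickening ε (segment ℝ a v)) ∧ Φ =ᶠ[𝓝 a] Φ₀ := by
  have hK : IsCompact (segment ℝ a v) := by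
    rw [segment_eq_image_lineMap]
    exact isCompact_Icc.image (by fun_prop)
  obtain ⟨δ, hδ, hδΨ⟩ : ∃ δ > 0, ∀ x ∈ segment ℝ a v, ∃ Ψ : W → V, IsLiftOn R Ψ (ball x δ) := by
    choose! Φ U hU hΦ using hloc
    obtain ⟨δ, hδ, h⟩ := lebesgue_number_lemma_of_metric (c := fun x : segment ℝ a v =>
      interior (U x)) hK (fun _ => isOpen_interior)
      (fun x hx => mem_iUnion.2 ⟨⟨x, hx⟩, mem_interior_iff_mem_nhds.2 (hU x hx)⟩)
    refine ⟨δ, hδ, fun x hx => ?_⟩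
    obtain ⟨i, hi⟩ := h x hx
    exact ⟨Φ i, (hΦ i i.2).mono (hi.trans interior_subset)⟩
  set p : ℝ →ᵃ[ℝ] W := AffineMap.lineMap a v with hp
  have hpc : ∀ s t, dist (p s) (p t) = |s - t| * dist a v := by
    intro s t
    rw [hp, dist_lineMap_lineMap, Real.dist_eq]
  have hpseg : ∀ t ∈ Icc (0 : ℝ) 1, p t ∈ segment ℝ a v := by
    intro t ht
    rw [segment_eq_image_lineMap]
    exact ⟨t, ht, rfl⟩
  have hp0 : p 0 = a := by simp [hp]
  -- Subdivision points are less than `δ / 2` apart, so the ball of radius `δ` at one of them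
  -- contains the `δ / 2`-neighbourhood of the next piece of the segment.
  obtain ⟨n, hn⟩ := exists_nat_gt (dist a v / (δ / 2))
  have hn0 : (0 : ℝ) < n := lt_of_le_of_lt (by positivity) hn
  have hstep : dist a v / n < δ / 2 := by
    rw [div_lt_iff₀ (by positivity)] at hn
    rw [div_lt_iff₀ hn0]
    linarith
  have hconv : ∀ k : ℕ, Convex ℝ (thickening (δ / 2) (p '' Icc (0 : ℝ) (k / n))) := fun k =>
    ((convex_Icc _ _).affine_image p).thickening _
  have key : ∀ k : ℕ, k ≤ n → ∃ Φ : W → V,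
      IsLiftOn R Φ (thickening (δ / 2) (p '' Icc (0 : ℝ) (k / n))) ∧ Φ =ᶠ[𝓝 a] Φ₀ := by
    intro k
    induction k with
    | zero =>
      intro _
      obtain ⟨Ψ, hΨ⟩ := hδΨ a (left_mem_segment ℝ a v)
      obtain ⟨ρ, hρ, hρU⟩ := Metric.mem_nhds_iff.1 (inter_mem hU₀ (ball_mem_nhds a hδ))
      obtain ⟨g, hg⟩ := IsLiftOn.exists_eqOn_smul hR (isOpen_ball (x := a) (ε := ρ))
        (convex_ball a ρ) ⟨a, mem_ball_self hρ⟩ (hΦ₀.mono fun x hx => (hρU hx).1)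
        (hΨ.mono fun x hx => (hρU hx).2)
      refine ⟨fun x => g • Ψ x, (hΨ.smul hR g).mono ?_, ?_⟩
      · simp only [Nat.cast_zero, zero_div, Icc_self, image_singleton, hp0, thickening_singleton]
        exact ball_subset_ball (by linarith)
      · filter_upwards [ball_mem_nhds a hρ] with x hx using (hg x hx).symm
    | succ k ih =>
      intro hk
      obtain ⟨Φ, hΦ, hΦ₀⟩ := ih (by omega)
      have hkn : (k : ℝ) / n ∈ Icc (0 : ℝ) 1 := by
        refine ⟨by positivity, ?_⟩
        rw [div_le_one hn0]
        exact_mod_cast (by omega : k ≤ n)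
      obtain ⟨Ψ, hΨ⟩ := hδΨ (p (k / n)) (hpseg _ hkn)
      have hmem : p (k / n) ∈ thickening (δ / 2) (p '' Icc (0 : ℝ) (k / n)) :=
        self_subset_thickening (half_pos hδ) _ ⟨_, ⟨hkn.1, le_rfl⟩, rfl⟩
      obtain ⟨F, hF, hFΦ⟩ := IsLiftOn.glue hR isOpen_thickening isOpen_ball (hconv k)
        (convex_ball (p (k / n)) δ) ⟨_, hmem, mem_ball_self hδ⟩ hΦ hΨ
      refine ⟨F, hF.mono ?_, ?_⟩
      · intro q hq
        obtain ⟨_, ⟨t, ht, rfl⟩, hqt⟩ := mem_thickening_iff.1 hq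
        by_cases htk : t ≤ k / n
        · exact Or.inl (mem_thickening_iff.2 ⟨_, ⟨t, ⟨ht.1, htk⟩, rfl⟩, hqt⟩)
        · right
          push Not at htk
          have h1 : |t - k / n| ≤ 1 / n := by
            rw [abs_of_pos (by linarith)]
            have := ht.2
            push_cast at this
            rw [add_div] at this
            linarith
          have h2 : dist (p t) (p (k / n)) < δ / 2 := by
            rw [hpc]
            calc |t - k / n| * dist a v ≤ 1 / n * dist a v := by gcongr
              _ = dist a v / n := by ring
              _ < δ / 2 := hstep
          rw [mem_ball]
          linarith [dist_triangle q (p t) (p (k / n))]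
      · have ha : a ∈ thickening (δ / 2) (p '' Icc (0 : ℝ) (k / n)) :=
          self_subset_thickening (half_pos hδ) _ ⟨0, ⟨le_rfl, hkn.1⟩, hp0⟩
        exact (hFΦ.eventuallyEq_of_mem (isOpen_thickening.mem_nhds ha)).trans hΦ₀
  obtain ⟨Φ, hΦ, h⟩ := key n le_rfl
  refine ⟨δ / 2, half_pos hδ, Φ, ?_, h⟩
  rw [div_self hn0.ne'] at hΦ
  rwa [segment_eq_image_lineMap]

/-- Lifts exist on sets whose points can be joined to a base point by segments along which lifts
exist locally. -/
theorem exists_lift_of_segments (hR : OrbitCorrespondence G H R) {a : W} {D : Set W}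
    (hD : IsOpen D) (ha : ∃ Φ : W → V, ∃ U ∈ 𝓝 a, IsLiftOn R Φ U)
    (hloc : ∀ v ∈ D, ∀ x ∈ segment ℝ a v, ∃ Φ : W → V, ∃ U ∈ 𝓝 x, IsLiftOn R Φ U) :
    ∃ Φ : W → V, IsLiftOn R Φ D := by
  have : CompleteSpace V := FiniteDimensional.complete ℂ V
  obtain ⟨Φ₀, U₀, hU₀, hΦ₀⟩ := ha
  have h := fun v hv => exists_lift_along_segment hR (hloc v hv) hU₀ hΦ₀
  choose! ε hε Φ hΦ hΦ₀' using h
  have hself : ∀ v ∈ D, v ∈ thickening (ε v) (segment ℝ a v) := fun v hv =>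
    self_subset_thickening (hε v hv) _ (right_mem_segment ℝ a v)
  have hbase : ∀ v ∈ D, a ∈ thickening (ε v) (segment ℝ a v) := fun v hv =>
    self_subset_thickening (hε v hv) _ (left_mem_segment ℝ a v)
  have hconv : ∀ v, Convex ℝ (thickening (ε v) (segment ℝ a v)) := fun v =>
    (convex_segment a v).thickening _
  -- For `x` near `v` the two continuations live on convex neighbourhoods with convex intersection
  -- containing `a` and `x`, and have the same germ at `a`; hence `Φ x x = Φ v x`, and there is no
  -- monodromy.
  refine ⟨fun v => Φ v v, fun v hv => ⟨?_, (hΦ v hv v (hself v hv)).2⟩⟩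
  refine (hΦ v hv v (hself v hv)).1.congr_of_eventuallyEq ?_
  filter_upwards [hD.mem_nhds hv, isOpen_thickening.mem_nhds (hself v hv)] with x hxD hxv
  exact eqOn_of_convex_of_eventuallyEq (isOpen_thickening.inter isOpen_thickening)
    ((hconv x).inter (hconv v))
    (fun y hy => (hΦ x hxD y hy.1).1.differentiableWithinAt)
    (fun y hy => (hΦ v hv y hy.2).1.differentiableWithinAt)
    ⟨hbase x hxD, hbase v hv⟩ ((hΦ₀' x hxD).trans (hΦ₀' v hv).symm) ⟨hself x hxD, hxv⟩

/-- A correspondence of orbits lifts on a convex open set if it lifts locally outside a finite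
union of subspaces of codimension at least two. -/
theorem OrbitCorrespondence.exists_lift_of_convex [FiniteDimensional ℂ W]
    (hR : OrbitCorrespondence G H R) {B : Set W} (hB : IsOpen B) (hconv : Convex ℝ B)
    (hne : B.Nonempty) (S : Set (Submodule ℂ W)) (hS : S.Finite)
    (hcodim : ∀ L ∈ S, Module.finrank ℂ L + 2 ≤ Module.finrank ℂ W)
    (hloc : ∀ x ∈ B, (∀ L ∈ S, x ∉ L) → ∃ Φ : W → V, ∃ U ∈ 𝓝 x, IsLiftOn R Φ U) :
    ∃ Φ : W → V, IsLiftOn R Φ B := by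
  classical
  have htop : ∀ L ∈ S, L ≠ ⊤ := by
    rintro L hL rfl
    have := hcodim _ hL
    rw [finrank_top] at this
    omega
  obtain ⟨a, haB, haS⟩ := (dense_forall_notMem_submodule S hS htop).inter_open_nonempty B hB hne
  -- By codimension two a hyperplane contains both `L` and `a`. A segment from `a` to a point off it
  -- meets it only at `a`, which is not in `L`.
  have hl : ∀ L ∈ S, ∃ l : W →L[ℂ] ℂ, l ≠ 0 ∧ l a = 0 ∧ ∀ x ∈ L, l x = 0 := by
    intro L hL
    have hlt : L ⊔ Submodule.span ℂ {a} < ⊤ := by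
      rw [lt_top_iff_ne_top]
      intro h
      have h1 := hcodim L hL
      have h2 := Submodule.finrank_add_le_finrank_add_finrank L (Submodule.span ℂ {a})
      have h3 : Module.finrank ℂ (Submodule.span ℂ {a}) = 1 := finrank_span_singleton
        (by rintro rfl; exact haS L hL L.zero_mem)
      rw [h, finrank_top] at h2
      omega
    obtain ⟨l, hl0, hle⟩ := Submodule.exists_le_ker_of_lt_top _ hlt
    refine ⟨LinearMap.toContinuousLinearMap l, fun h => hl0 ?_, ?_, fun x hx => ?_⟩
    · exact LinearMap.toContinuousLinearMap.map_eq_zero_iff.1 h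
    · exact hle (Submodule.mem_sup_right (Submodule.mem_span_singleton_self a))
    · exact hle (Submodule.mem_sup_left hx)
  choose! l hl0 hla hlL using hl
  set s : Finset (W →L[ℂ] ℂ) := hS.toFinset.image l with hs
  have hs0 : ∀ m ∈ s, m ≠ 0 := by
    intro m hm
    obtain ⟨L, hL, rfl⟩ := Finset.mem_image.1 hm
    exact hl0 L (hS.mem_toFinset.1 hL)
  have hDo : IsOpen (B ∩ {x | ∀ m ∈ s, m x ≠ 0}) := hB.inter (isOpen_forall_apply_ne_zero s)
  obtain ⟨F, hF⟩ := exists_lift_of_segments hR hDo (hloc a haB haS) (by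
    rintro v ⟨hvB, hvs⟩ x hx
    refine hloc x (hconv.segment_subset haB hvB hx) fun L hL hxL => ?_
    rw [segment_eq_image_lineMap] at hx
    obtain ⟨t, -, rfl⟩ := hx
    have h1 := hlL L hL _ hxL
    rw [AffineMap.lineMap_apply_module, ← Complex.coe_smul, ← Complex.coe_smul, map_add, map_smul,
      map_smul, hla L hL, smul_zero, zero_add, smul_eq_mul, mul_eq_zero] at h1
    have h2 : t = 0 := by
      exact_mod_cast h1.resolve_right
        (hvs _ (Finset.mem_image_of_mem l (hS.mem_toFinset.2 hL)))
    rw [h2, AffineMap.lineMap_apply_zero] at hxL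
    exact haS L hL hxL)
  -- `F` is locally bounded: if `R v x`, then for `y` near `x` the value `F y` is one of the
  -- finitely many `G`-translates of a point near `v`.
  obtain ⟨Φ, hΦ, hΦF⟩ := exists_differentiableOn_extension hB s hs0 (f := F)
    (fun x hx => (hF x hx).1.differentiableWithinAt) (fun x hx => by
      have := Fintype.ofFinite G
      obtain ⟨v, hv⟩ := hR.exists_left x
      refine ⟨(∑ g : G, ‖LinearMap.toContinuousLinearMap ((g : V ≃ₗ[ℂ] V) : V →ₗ[ℂ] V)‖) *
        (‖v‖ + 1), ?_⟩
      filter_upwards [hR.eventually_exists hv _ (ball_mem_nhds v one_pos), hB.mem_nhds hx]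
        with y hy hyB hys
      obtain ⟨v', hv', hyv'⟩ := hy
      obtain ⟨g, hg⟩ := hR.transitive_left hyv' (hF y ⟨hyB, hys⟩).2
      have h1 : ‖v'‖ ≤ ‖v‖ + 1 := by
        have h2 := norm_le_norm_add_norm_sub' v' v
        rw [mem_ball, dist_eq_norm] at hv'
        linarith
      rw [hg]
      calc ‖g • v'‖ ≤ ‖LinearMap.toContinuousLinearMap ((g : V ≃ₗ[ℂ] V) : V →ₗ[ℂ] V)‖ * ‖v'‖ :=
            (LinearMap.toContinuousLinearMap ((g : V ≃ₗ[ℂ] V) : V →ₗ[ℂ] V)).le_opNorm v'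
        _ ≤ _ := by
            gcongr
            exact Finset.single_le_sum (f := fun g : G =>
              ‖LinearMap.toContinuousLinearMap ((g : V ≃ₗ[ℂ] V) : V →ₗ[ℂ] V)‖)
              (fun _ _ => norm_nonneg _) (Finset.mem_univ g))
  refine ⟨Φ, fun x hx => ?_⟩
  have hd : DifferentiableAt ℂ Φ x := hΦ.differentiableAt (hB.mem_nhds hx)
  refine ⟨hd, ?_⟩
  have ht : Tendsto (fun y => (Φ y, y)) (𝓝 x) (𝓝 (Φ x, x)) :=
    hd.continuousAt.prodMk continuousAt_id
  -- The relation survives on the hyperplanes because `R` is closed.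
  refine IsClosed.mem_of_frequently_of_tendsto (s := {p : V × W | R p.1 p.2}) hR.isClosed ?_ ht
  have := (mem_closure_iff_frequently.1 (dense_forall_apply_ne_zero s hs0 x)).and_eventually
    (hB.mem_nhds hx)
  refine this.mono fun y hy => ?_
  change R (Φ y) y
  rw [hΦF y hy.1]
  exact (hF y ⟨hy.2, hy.1⟩).2

end Continuation

end FiniteQuotient

namespace FiniteQuotient

/-! ### Jacobians of lifts, preservation of isotropy type, and the global lift. -/

section Lifting

variable {V : Type*} [NormedAddCommGroup V] [NormedSpace ℂ V] [FiniteDimensional ℂ V]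
  {W : Type*} [NormedAddCommGroup W] [NormedSpace ℂ W] [FiniteDimensional ℂ W]
  {G : Subgroup (V ≃ₗ[ℂ] V)} [Finite G] {H : Subgroup (W ≃ₗ[ℂ] W)} [Finite H]
  {R : V → W → Prop}

omit [FiniteDimensional ℂ W] [Finite G] in
theorem fderiv_const_smul_comp {g : G} {Φ : W → V} {x : W} (h : DifferentiableAt ℂ Φ x) (u : W) :
    fderiv ℂ (fun y => g • Φ y) x u = g • fderiv ℂ Φ x u := by
  have h1 := (LinearMap.toContinuousLinearMap
    ((g : V ≃ₗ[ℂ] V) : V →ₗ[ℂ] V)).hasFDerivAt.comp x h.hasFDerivAt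
  have h2 : fderiv ℂ (fun y => g • Φ y) x = _ := h1.fderiv
  rw [h2]
  rfl

omit [FiniteDimensional ℂ V] in
-- Near `x` the composite `Ψ ∘ Φ` is one fixed linear automorphism `k`; the chain rule does the
-- rest.
theorem injective_fderiv_of_comp_eq_smul {Φ : W → V} {Ψ : V → W} {x : W}
    (hΦ : ∀ᶠ y in 𝓝 x, DifferentiableAt ℂ Φ y)
    (hΨ : ∀ᶠ y in 𝓝 (Φ x), DifferentiableAt ℂ Ψ y)
    (h : ∀ᶠ y in 𝓝 x, ∃ k : H, Ψ (Φ y) = k • y) :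
    Function.Injective (fderiv ℂ Φ x) ∧ Function.Surjective (fderiv ℂ Ψ (Φ x)) := by
  have hc : ContinuousAt Φ x := hΦ.self_of_nhds.continuousAt
  obtain ⟨ρ, hρ, hball⟩ := Metric.eventually_nhds_iff_ball.1
    (hΦ.and ((hc.eventually hΨ).and h))
  obtain ⟨k, hk⟩ := exists_eqOn_smul (isOpen_ball (x := x) (ε := ρ)) (convex_ball x ρ)
    ⟨x, mem_ball_self hρ⟩ (F₁ := fun y => Ψ (Φ y)) (F₂ := fun y => y)
    (fun y hy => (hball y hy).2.1.comp y (hball y hy).1) (fun y _ => differentiableAt_id)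
    (fun y hy => (hball y hy).2.2)
  have h1 : ∀ u, fderiv ℂ Ψ (Φ x) (fderiv ℂ Φ x u) = k • u := by
    intro u
    have h2 : fderiv ℂ (fun y => Ψ (Φ y)) x u = fderiv ℂ (fun y => k • y) x u := by
      rw [Filter.EventuallyEq.fderiv_eq (f := fun y => k • y)]
      filter_upwards [ball_mem_nhds x hρ] with y hy using hk y hy
    rw [fderiv_const_smul_comp (Φ := fun y => y) differentiableAt_id, fderiv_fun_id] at h2
    have h3 := (hΨ.self_of_nhds.hasFDerivAt.comp x hΦ.self_of_nhds.hasFDerivAt).fderiv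
    rw [show (Ψ ∘ Φ) = fun y => Ψ (Φ y) from rfl] at h3
    rw [h3] at h2
    exact h2
  refine ⟨fun a b hab => ?_, fun b => ⟨fderiv ℂ Φ x (k⁻¹ • b), ?_⟩⟩
  · have := h1 a
    rw [hab, h1 b] at this
    exact (smul_left_cancel k this).symm
  · rw [h1, smul_inv_smul]

theorem OrbitCorrespondence.bijective_fderiv (hR : OrbitCorrespondence G H R)
    (hR' : OrbitCorrespondence H G fun w v => R v w) {w : W} {Φ : W → V} {U : Set W}
    (hU : U ∈ 𝓝 w) (hΦ : IsLiftOn R Φ U) (hv : FixesHyperplane G (Φ w))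
    (hw : FixesHyperplane H w) : Function.Bijective (fderiv ℂ Φ w) := by
  have hw' : w ∈ U := mem_of_mem_nhds hU
  obtain ⟨Ψ, hΨw, hΨ⟩ := hR'.exists_local_lift hR (hΦ w hw').2 hw hv
  have hΦd : ∀ᶠ y in 𝓝 w, DifferentiableAt ℂ Φ y := by
    filter_upwards [hU] with y hy using (hΦ y hy).1
  have hΨd : ∀ᶠ y in 𝓝 (Φ w), DifferentiableAt ℂ Ψ y := hΨ.mono fun y hy => hy.1
  refine ⟨(injective_fderiv_of_comp_eq_smul (H := H) hΦd hΨd ?_).1, ?_⟩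
  · filter_upwards [hU, (hΦ w hw').1.continuousAt.eventually hΨ] with y hy hΨy
    exact hR'.transitive_left (hΦ y hy).2 hΨy.2
  · have h1 := (injective_fderiv_of_comp_eq_smul (H := G) (Φ := Ψ) (Ψ := Φ) (x := Φ w) hΨd
      (by rw [hΨw]; exact hΦd) ?_).2
    · rwa [hΨw] at h1
    · have h2 : U ∈ 𝓝 (Ψ (Φ w)) := by rwa [hΨw]
      filter_upwards [hΨ, hΨ.self_of_nhds.1.continuousAt.eventually h2] with y hy hyU
      exact hR.transitive_left hy.2 (hΦ _ hyU).2

theorem differentiableAt_det_fderiv {B : Set W} (hB : IsOpen B) {Φ : W → V}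
    (hΦ : DifferentiableOn ℂ Φ B) (L : V →ₗ[ℂ] W) {x : W} (hx : x ∈ B) :
    DifferentiableAt ℂ
      (fun y => LinearMap.det (L ∘ₗ (fderiv ℂ Φ y : W →ₗ[ℂ] V))) x := by
  classical
  set b := Module.finBasis ℂ W
  have h1 : ∀ y, LinearMap.det (L ∘ₗ (fderiv ℂ Φ y : W →ₗ[ℂ] V)) =
      ∑ σ : Equiv.Perm (Fin (Module.finrank ℂ W)), ((Equiv.Perm.sign σ : ℤ) : ℂ) *
        ∏ i, LinearMap.toContinuousLinearMap (b.coord (σ i) ∘ₗ L) (fderiv ℂ Φ y (b i)) := by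
    intro y
    rw [← LinearMap.det_toMatrix b, Matrix.det_apply']
    simp only [LinearMap.toMatrix_apply]
    rfl
  simp only [h1]
  refine DifferentiableAt.fun_sum fun σ _ => DifferentiableAt.const_mul ?_ _
  have h2 : ∀ i, DifferentiableAt ℂ (fun y =>
      LinearMap.toContinuousLinearMap (b.coord (σ i) ∘ₗ L) (fderiv ℂ Φ y (b i))) x := fun i =>
    (ContinuousLinearMap.differentiableAt _).comp x (differentiableAt_fderiv_apply hB hΦ (b i) hx)
  exact (HasFDerivAt.finsetProd fun i _ => (h2 i).hasFDerivAt).differentiableAt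

variable (H) in
/-- The isotropy subspaces of codimension at least two. -/
def smallIsotropySubspaces : Set (Submodule ℂ W) :=
  {L ∈ range (isotropySubspace H) | Module.finrank ℂ L + 2 ≤ Module.finrank ℂ W}

omit [FiniteDimensional ℂ W] in
theorem finite_smallIsotropySubspaces : (smallIsotropySubspaces H).Finite :=
  (finite_range_isotropySubspace H).subset (sep_subset _ _)

omit [FiniteDimensional ℂ W] [Finite H] in
theorem fixesHyperplane_of_forall_notMem {x : W} (hx : ∀ L ∈ smallIsotropySubspaces H, x ∉ L) :
    FixesHyperplane H x := by
  by_contra h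
  exact hx _ ⟨⟨x, rfl⟩, finrank_isotropySubspace_add_two_le h⟩ (mem_isotropySubspace_self H x)

theorem dense_forall_notMem_smallIsotropySubspaces :
    Dense {x : W | ∀ L ∈ smallIsotropySubspaces H, x ∉ L} := by
  refine dense_forall_notMem_submodule _ finite_smallIsotropySubspaces ?_
  rintro L hL rfl
  have := hL.2
  rw [finrank_top] at this
  omega

/-- Nothing is assumed on the isotropy of `w`: nearby points are all related to points with good
isotropy in `V`, and outside codimension two they have good isotropy themselves, so local lifts
exist there. -/
theorem OrbitCorrespondence.exists_isLiftOn_ball (hR : OrbitCorrespondence G H R)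
    (hR' : OrbitCorrespondence H G fun w v => R v w) {v : V} {w : W} (hvw : R v w)
    (hv : FixesHyperplane G v) : ∃ ρ > 0, ∃ Φ : W → V, IsLiftOn R Φ (ball w ρ) ∧
      ∀ x ∈ ball w ρ, FixesHyperplane G (Φ x) := by
  obtain ⟨ρ, hρ, hball⟩ := Metric.eventually_nhds_iff_ball.1
    (hR.eventually_exists hvw _ hv.eventually)
  obtain ⟨Φ, hΦ⟩ := hR.exists_lift_of_convex (isOpen_ball (x := w) (ε := ρ)) (convex_ball w ρ)
    ⟨w, mem_ball_self hρ⟩ (smallIsotropySubspaces H) finite_smallIsotropySubspaces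
    (fun L hL => hL.2) (fun x hx hxS => by
      obtain ⟨y, hy, hyx⟩ := hball x hx
      obtain ⟨Φ, -, hΦ⟩ := hR.exists_local_lift hR' hyx hy (fixesHyperplane_of_forall_notMem hxS)
      exact ⟨Φ, _, hΦ, fun _ h => h⟩)
  refine ⟨ρ, hρ, Φ, hΦ, fun x hx => ?_⟩
  obtain ⟨y, hy, hyx⟩ := hball x hx
  obtain ⟨g, hg⟩ := hR.transitive_left hyx (hΦ x hx).2
  rw [hg]
  exact hy.smul g

/-- The derivative at one point `x₁` with good isotropy identifies `W` with `V`. The resulting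
Jacobian determinant has no zeros off codimension two, hence none at all. -/
theorem OrbitCorrespondence.bijective_fderiv_of_isLiftOn_ball (hR : OrbitCorrespondence G H R)
    (hR' : OrbitCorrespondence H G fun w v => R v w) {w : W} {ρ : ℝ} (hρ : 0 < ρ) {Φ : W → V}
    (hΦ : IsLiftOn R Φ (ball w ρ)) (hgood : ∀ x ∈ ball w ρ, FixesHyperplane G (Φ x)) :
    Function.Bijective (fderiv ℂ Φ w) := by
  have hbij : ∀ x ∈ ball w ρ, (∀ L ∈ smallIsotropySubspaces H, x ∉ L) →
      Function.Bijective (fderiv ℂ Φ x) := fun x hx hxS =>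
    hR.bijective_fderiv hR' (isOpen_ball.mem_nhds hx) hΦ (hgood x hx)
      (fixesHyperplane_of_forall_notMem hxS)
  obtain ⟨x₁, hx₁, hx₁S⟩ := (dense_forall_notMem_smallIsotropySubspaces (H := H)).inter_open_nonempty
    (ball w ρ) isOpen_ball ⟨w, mem_ball_self hρ⟩
  set L : W ≃ₗ[ℂ] V := LinearEquiv.ofBijective (fderiv ℂ Φ x₁ : W →ₗ[ℂ] V) (hbij x₁ hx₁ hx₁S)
  have hd : DifferentiableOn ℂ Φ (ball w ρ) := fun x hx => (hΦ x hx).1.differentiableWithinAt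
  have hdet := ne_zero_of_ne_zero_off_codim_two (isOpen_ball (x := w) (ε := ρ))
    (J := fun y => LinearMap.det ((L.symm : V →ₗ[ℂ] W) ∘ₗ (fderiv ℂ Φ y : W →ₗ[ℂ] V)))
    (fun x hx => (differentiableAt_det_fderiv isOpen_ball hd _ hx).differentiableWithinAt)
    (smallIsotropySubspaces H) finite_smallIsotropySubspaces (fun L hL => hL.2)
    (fun x hx hxS => by
      have h := (LinearEquiv.ofBijective (fderiv ℂ Φ x : W →ₗ[ℂ] V) (hbij x hx hxS)
        |>.trans L.symm).isUnit_det'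
      exact h.ne_zero) (mem_ball_self hρ)
  have h1 := (LinearMap.equivOfDetNeZero _ hdet).bijective
  have h2 : Function.Bijective (L.symm ∘ fderiv ℂ Φ w) := h1
  exact (Function.Bijective.of_comp_iff' L.symm.bijective _).1 h2

/-- A correspondence of orbits preserves the points whose isotropy groups fix hyperplanes. -/
theorem OrbitCorrespondence.fixesHyperplane (hR : OrbitCorrespondence G H R)
    (hR' : OrbitCorrespondence H G fun w v => R v w) {v : V} {w : W} (hvw : R v w)
    (hv : FixesHyperplane G v) : FixesHyperplane H w := by
  obtain ⟨ρ, hρ, Φ, hΦ, hgood⟩ := hR.exists_isLiftOn_ball hR' hvw hv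
  have hbij := hR.bijective_fderiv_of_isLiftOn_ball hR' hρ hΦ hgood
  have hw : w ∈ ball w ρ := mem_ball_self hρ
  set L : W ≃ₗ[ℂ] V := LinearEquiv.ofBijective (fderiv ℂ Φ w : W →ₗ[ℂ] V) hbij with hL
  -- For `h` fixing `w`, `x ↦ Φ (h • x)` is another lift, so it equals `κ • Φ` near `w`, with `κ`
  -- fixing `Φ w`. Thus the inverse derivative carries vectors fixed by every such `κ` to vectors
  -- fixed by `h`.
  have hle : (isotropySubspace G (Φ w)).map (L.symm : V →ₗ[ℂ] W) ≤ isotropySubspace H w := by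
    rintro _ ⟨u, hu, rfl⟩ h hh
    have hhw : h • w = w := hh
    have hc : ContinuousAt (fun x : W => h • x) w := (continuous_const_smul h).continuousAt
    obtain ⟨δ, hδ, hball⟩ := Metric.eventually_nhds_iff_ball.1
      ((hc.eventually (p := (· ∈ ball w ρ))
        (by simp only [hhw]; exact ball_mem_nhds w hρ)).and (ball_mem_nhds w hρ))
    have hdh : ∀ x, DifferentiableAt ℂ (fun y : W => h • y) x := fun x =>
      differentiableAt_const_smul_comp (Φ := fun y => y) differentiableAt_id
    have hlift : IsLiftOn R (fun x => Φ (h • x)) (ball w δ) := by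
      intro x hx
      have h1 := hΦ _ (hball x hx).1
      refine ⟨h1.1.comp x (hdh x), ?_⟩
      have h2 := hR.smul_right h⁻¹ h1.2
      rwa [inv_smul_smul] at h2
    obtain ⟨κ, hκ⟩ := IsLiftOn.exists_eqOn_smul hR isOpen_ball (convex_ball w δ)
      ⟨w, mem_ball_self hδ⟩ hlift (hΦ.mono fun x hx => (hball x hx).2)
    have hκw := hκ w (mem_ball_self hδ)
    simp only [hhw] at hκw
    have hκu : κ • u = u := hu κ hκw.symm
    have hfd : ∀ a, fderiv ℂ Φ w (h • a) = κ • fderiv ℂ Φ w a := by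
      intro a
      have heq : (fun x => Φ (h • x)) =ᶠ[𝓝 w] fun x => κ • Φ x := by
        filter_upwards [ball_mem_nhds w hδ] with x hx using hκ x hx
      rw [← fderiv_const_smul_comp (hΦ w hw).1, ← heq.fderiv_eq]
      have h1 : HasFDerivAt Φ (fderiv ℂ Φ w) (h • w) := by
        rw [hhw]
        exact (hΦ w hw).1.hasFDerivAt
      have h2 : fderiv ℂ (fun x => Φ (h • x)) w = _ := (h1.comp w (hdh w).hasFDerivAt).fderiv
      rw [h2, ContinuousLinearMap.comp_apply,
        fderiv_const_smul_comp (Φ := fun y => y) differentiableAt_id, fderiv_fun_id]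
      rfl
    have hLu : fderiv ℂ Φ w (L.symm u) = u := L.apply_symm_apply u
    refine hbij.injective ?_
    change fderiv ℂ Φ w (h • L.symm u) = fderiv ℂ Φ w (L.symm u)
    rw [hfd, hLu, hκu]
  have h1 := Submodule.finrank_mono hle
  rw [LinearEquiv.finrank_map_eq] at h1
  have h2 := L.finrank_eq
  have h3 := hgood w hw
  unfold FixesHyperplane at h3 ⊢
  omega

theorem OrbitCorrespondence.exists_lift (hR : OrbitCorrespondence G H R)
    (hR' : OrbitCorrespondence H G fun w v => R v w) :
    ∃ Φ : W → V, Differentiable ℂ Φ ∧ ∀ w, R (Φ w) w := by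
  obtain ⟨Φ, hΦ⟩ := hR.exists_lift_of_convex isOpen_univ convex_univ ⟨0, trivial⟩
    (smallIsotropySubspaces H) finite_smallIsotropySubspaces (fun L hL => hL.2)
    (fun x _ hxS => by
      have hx : FixesHyperplane H x := fixesHyperplane_of_forall_notMem hxS
      obtain ⟨y, hyx⟩ := hR.exists_left x
      obtain ⟨Φ, -, hΦ⟩ := hR.exists_local_lift hR' hyx (hR'.fixesHyperplane hR hyx hx) hx
      exact ⟨Φ, _, hΦ, fun _ h => h⟩)
  exact ⟨Φ, fun w => (hΦ w trivial).1, fun w => (hΦ w trivial).2⟩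

/-- Each composite of the two global lifts preserves orbits, so it is a single group element on the
whole space; correcting `Φ` by `h⁻¹` makes it the inverse of `Ψ`. -/
theorem OrbitCorrespondence.exists_equiv (hR : OrbitCorrespondence G H R)
    (hR' : OrbitCorrespondence H G fun w v => R v w) :
    ∃ F : V ≃ W, Differentiable ℂ F ∧ Differentiable ℂ F.symm ∧ ∀ v, R v (F v) := by
  obtain ⟨Φ, hΦ, hΦR⟩ := hR.exists_lift hR'
  obtain ⟨Ψ, hΨ, hΨR⟩ := hR'.exists_lift hR
  obtain ⟨h, hh⟩ := exists_eqOn_smul (G := H) (isOpen_univ (X := W)) convex_univ ⟨0, trivial⟩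
    (F₁ := fun w => Ψ (Φ w)) (F₂ := fun w => w) (fun w _ => (hΨ.comp hΦ) w)
    (fun w _ => differentiableAt_id) (fun w _ => hR'.transitive_left (hΦR w) (hΨR (Φ w)))
  obtain ⟨g, hg⟩ := exists_eqOn_smul (G := G) (isOpen_univ (X := V)) convex_univ ⟨0, trivial⟩
    (F₁ := fun v => Φ (Ψ v)) (F₂ := fun v => v) (fun v _ => (hΦ.comp hΨ) v)
    (fun v _ => differentiableAt_id) (fun v _ => hR.transitive_left (hΨR v) (hΦR (Ψ v)))
  have hinj : Function.Injective Ψ := fun a b hab => by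
    have h1 := hg a trivial
    have h2 := hg b trivial
    simp only [hab] at h1
    rw [h1] at h2
    exact smul_left_cancel g h2
  have hright : ∀ w, Ψ (Φ (h⁻¹ • w)) = w := fun w => by
    rw [hh _ trivial, smul_inv_smul]
  refine ⟨⟨Ψ, fun w => Φ (h⁻¹ • w), fun v => hinj (hright (Ψ v)), hright⟩, hΨ, ?_, hΨR⟩
  exact hΦ.comp fun w => differentiableAt_const_smul_comp (Φ := fun y => y) differentiableAt_id

omit [FiniteDimensional ℂ V] [FiniteDimensional ℂ W] [Finite G] [Finite H] in
theorem image_orbit_eq (f : OrbitSpace G ≃ OrbitSpace H) (F : V ≃ W)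
    (hF : ∀ v, proj H (F v) = f (proj G v)) (v : V) :
    F '' MulAction.orbit G v = MulAction.orbit H (F v) := by
  ext w
  constructor
  · rintro ⟨_, ⟨g, rfl⟩, rfl⟩
    obtain ⟨h, hh⟩ := (proj_eq_proj_iff H).1
      (show proj H (F (g • v)) = proj H (F v) by rw [hF, hF, proj_smul])
    exact ⟨h, hh.symm⟩
  · rintro ⟨h, rfl⟩
    obtain ⟨g, hg⟩ := (proj_eq_proj_iff G).1
      (show proj G (F.symm (h • F v)) = proj G v from f.injective (by
        rw [← hF, ← hF, F.apply_symm_apply, proj_smul]))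
    exact ⟨F.symm (h • F v), ⟨g, hg.symm⟩, F.apply_symm_apply _⟩

end Lifting

end FiniteQuotient

end

theorem mainTheorem3
    {V : Type*} [NormedAddCommGroup V] [NormedSpace ℂ V] [FiniteDimensional ℂ V]
    {W : Type*} [NormedAddCommGroup W] [NormedSpace ℂ W] [FiniteDimensional ℂ W]
    (G : Subgroup (V ≃ₗ[ℂ] V)) [Finite G] (H : Subgroup (W ≃ₗ[ℂ] W)) [Finite H]
    (hkl : (FiniteQuotient.codimOneStrata G).ncard = (FiniteQuotient.codimOneStrata H).ncard)
    (f : FiniteQuotient.OrbitSpace G ≃ FiniteQuotient.OrbitSpace H)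
    (hf : FiniteQuotient.IsBiholomorphism G H f)
    (hstrata : ∀ (C : Set (FiniteQuotient.OrbitSpace G)) (r : ℕ),
      FiniteQuotient.IsCodimOneStratum G C r →
        ∃ D : Set (FiniteQuotient.OrbitSpace H),
          FiniteQuotient.IsCodimOneStratum H D r ∧ f '' closure C = closure D) :
    ∃ F : V ≃ W,
      (Differentiable ℂ F ∧ Differentiable ℂ F.symm) ∧
      (∀ v : V, F '' MulAction.orbit G v = MulAction.orbit H (F v)) ∧
      (∀ w : W, F.symm '' MulAction.orbit H w = MulAction.orbit G (F.symm w)) ∧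
      (∀ v : V, FiniteQuotient.proj H (F v) = f (FiniteQuotient.proj G v)) := by
  have hstrata' := FiniteQuotient.exists_codimOneStratum_symm hkl f hstrata
  have hR := FiniteQuotient.orbitCorrespondence_of_isBiholomorphism f hf hstrata hstrata'
  have hR' := FiniteQuotient.orbitCorrespondence_of_isBiholomorphism f.symm ⟨hf.2, hf.1⟩ hstrata'
    hstrata
  have hsymm : (fun (w : W) (v : V) =>
      f.symm (FiniteQuotient.proj H w) = FiniteQuotient.proj G v) =
      fun w v => f (FiniteQuotient.proj G v) = FiniteQuotient.proj H w := by
    funext w v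
    rw [Equiv.symm_apply_eq]
    exact propext eq_comm
  rw [hsymm] at hR'
  obtain ⟨F, hF, hF', hFR⟩ := hR.exists_equiv hR'
  refine ⟨F, ⟨hF, hF'⟩, FiniteQuotient.image_orbit_eq f F fun v => (hFR v).symm,
    FiniteQuotient.image_orbit_eq f.symm F.symm fun w => ?_, fun v => (hFR v).symm⟩
  rw [Equiv.eq_symm_apply, hFR, F.apply_symm_apply]
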